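/- **Theorem (Existence of a static ground state).** Let $\sigma\in(\tfrac14,1]$. Write $H^\sigma=H^\sigma(\mathbb R;\mathbb C)$ for the Sobolev space $\{u\in L^2(\mathbb R;\mathbb C):(1+|\xi|^2)^{\sigma/2}\hat u\in L^2\}$, where $\hat u(\xi)=\int_{\mathbb R}e^{-2\pi i x\xi}u(x)\,dx$, and for $s\geq 0$ let $|\nabla|^s=(-\Delta)^{s/2}$ be the Fourier multiplier with symbol $|2\pi\xi|^s$. For nonzero $u\in H^\sigma$ define the Weinstein functional $$W(u)=\frac{\|u\|_{L^2}^{\frac{4\sigma-1}{\sigma}}\,\||\nabla|^\sigma u\|_{L^2}^{\frac1\sigma}}{\|u\|_{L^4}^4}.$$ Then there exists a nonzero real-valued $Q\in H^\sigma$ which minimizes $W$ over all nonzero $u\in H^\sigma$, that is, $W(Q)\le W(u)$ for every nonzero $u\in H^\sigma$, and which solves the ground state equation $$(-\Delta)^\sigma Q+Q-Q^3=0$$ in the weak sense: for every $v\in H^\sigma$, $$\int_{\mathbb R}|2\pi\xi|^{2\sigma}\,\hat Q(\xi)\,\overline{\hat v(\xi)}\,d\xi+\int_{\mathbb R}Q\,\overline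 v\,dx-\int_{\mathbb R}Q^3\,\overline v\,dx=0 .$$ -/

import Mathlib

open MeasureTheory FourierTransform
open scoped SchwartzMap ENNReal ComplexConjugate

/-- `L²(ℝ; ℂ)` with respect to Lebesgue measure. -/
abbrev L2R : Type := Lp ℂ 2 (volume : Measure ℝ)

/-- The Sobolev space `H^s(ℝ; ℂ)` for `s ≥ 0`, as a set of (classes of) `L²` functions, through
Mathlib's Bessel potential spaces `H^{s,p}` with `p = 2`. -/
def SobolevH (s : ℝ) : Set L2R :=
  {u | TemperedDistribution.MemSobolev s 2 (u : 𝓢'(ℝ, ℂ))}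

/-- The function `ξ ↦ |2πξ|^s û(ξ)`, where `û = 𝓕 u` is the `L²` Fourier transform in the
normalization `û(ξ) = ∫ e^{-2πixξ} u(x) dx`; thus `|2πξ|` is the symbol of `|∇| = (-Δ)^{1/2}`. -/
noncomputable def fracSymbolMul (s : ℝ) (u : L2R) : ℝ → ℂ :=
  fun ξ ↦ ((|2 * Real.pi * ξ| ^ s : ℝ) : ℂ) * (𝓕 u : L2R) ξ

/-- On `H^s` the function `|2πξ|^s û(ξ)` is square integrable. -/
theorem memLp_fracSymbolMul {s : ℝ} (hs : 0 ≤ s) {u : L2R} (hu : u ∈ SobolevH s) :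
    MemLp (fracSymbolMul s u) 2 (volume : Measure ℝ) := by
  obtain ⟨f', hf'⟩ := TemperedDistribution.memSobolev_iff_exists_smulLeftCLM_fourier.mp hu
  have hb : MemLp (fun x : ℝ ↦ (((1 + ‖x‖ ^ 2) ^ (-s / 2) : ℝ) : ℂ)) ∞
      (volume : Measure ℝ) := by
    refine memLp_top_of_bound ?_ 1 (Filter.Eventually.of_forall fun x ↦ ?_)
    · have h : (fun x : ℝ ↦ ((1 + ‖x‖ ^ 2) ^ (-s / 2) : ℝ)).HasTemperateGrowth := by fun_prop
      exact (Complex.continuous_ofReal.comp h.1.continuous).aestronglyMeasurable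
    · rw [Complex.norm_real, Real.norm_eq_abs, abs_of_nonneg (by positivity)]
      exact Real.rpow_le_one_of_one_le_of_nonpos (by nlinarith [sq_nonneg ‖x‖]) (by linarith)
  have key : hb.toLp _ • f' = (𝓕 u : L2R) := by
    have h0 : ((hb.toLp _ • f' : L2R) : 𝓢'(ℝ, ℂ)) = ((𝓕 u : L2R) : 𝓢'(ℝ, ℂ)) := by
      rw [MeasureTheory.Lp.toTemperedDistribution_smul_eq (by fun_prop), ← hf',
        TemperedDistribution.smulLeftCLM_smulLeftCLM_apply (by fun_prop) (by fun_prop),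
        ← Lp.fourier_toTemperedDistribution_eq]
      have h1 : ((fun x : ℝ ↦ (((1 + ‖x‖ ^ 2) ^ (-s / 2) : ℝ) : ℂ)) *
          fun x : ℝ ↦ (((1 + ‖x‖ ^ 2) ^ (s / 2) : ℝ) : ℂ)) = fun _ ↦ 1 := by
        ext x
        rw [Pi.mul_apply, ← Complex.ofReal_mul, ← Real.rpow_add (by positivity), neg_div,
          neg_add_cancel, Real.rpow_zero, Complex.ofReal_one]
      first
        | rw [h1, TemperedDistribution.smulLeftCLM_const, one_smul]
        | rw [mul_comm, h1, TemperedDistribution.smulLeftCLM_const, one_smul]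
    have hk := Lp.ker_toTemperedDistributionCLM_eq_bot (E := ℝ) (F := ℂ) (p := 2)
      (μ := (volume : Measure ℝ))
    exact (LinearMap.ker_eq_bot.mp hk) h0
  have hae : ∀ᵐ x : ℝ, (𝓕 u : L2R) x = (((1 + ‖x‖ ^ 2) ^ (-s / 2) : ℝ) : ℂ) * f' x := by
    rw [← key]
    filter_upwards [Lp.coeFn_lpSMul (r := 2) (hb.toLp _) f', hb.coeFn_toLp] with x h1 h2
    rw [h1, Pi.smul_apply', h2, smul_eq_mul]
  refine (Lp.memLp f').of_le_mul (c := (2 * Real.pi) ^ s) ?_ ?_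
  · unfold fracSymbolMul
    refine AEStronglyMeasurable.mul ?_ (Lp.aestronglyMeasurable _)
    exact (by fun_prop : Measurable
      fun ξ : ℝ ↦ ((|2 * Real.pi * ξ| ^ s : ℝ) : ℂ)).aestronglyMeasurable
  · filter_upwards [hae] with x hx
    rw [fracSymbolMul, hx, ← mul_assoc, norm_mul]
    refine mul_le_mul_of_nonneg_right ?_ (norm_nonneg _)
    rw [norm_mul, Complex.norm_real, Complex.norm_real,
      Real.norm_of_nonneg (Real.rpow_nonneg (abs_nonneg _) s),
      Real.norm_of_nonneg (by positivity : (0 : ℝ) ≤ (1 + ‖x‖ ^ 2) ^ (-s / 2)), abs_mul,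
      abs_of_pos (by positivity : 0 < 2 * Real.pi),
      Real.mul_rpow (by positivity) (abs_nonneg _), mul_assoc]
    refine mul_le_of_le_one_right (by positivity) ?_
    rw [neg_div, Real.rpow_neg (by positivity), ← div_eq_mul_inv]
    refine div_le_one_of_le₀ ?_ (by positivity)
    calc |x| ^ s = (‖x‖ ^ 2) ^ (s / 2) := by
          rw [← Real.rpow_natCast, ← Real.rpow_mul (norm_nonneg _), Real.norm_eq_abs]
          congr 1
          push_cast
          ring
      _ ≤ _ := Real.rpow_le_rpow (by positivity) (by linarith) (by linarith)

open Classical in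
/-- The operator `|∇|^s = (-Δ)^{s/2}` on `L²(ℝ)`: the Fourier multiplier with symbol `|2πξ|^s`.
Its natural domain contains `H^s` (`memLp_fracSymbolMul`); outside the domain the value is `0`. -/
noncomputable def fracDeriv (s : ℝ) (u : L2R) : L2R :=
  if h : MemLp (fracSymbolMul s u) 2 (volume : Measure ℝ) then 𝓕⁻ (h.toLp _ : L2R) else 0

/-- The Weinstein functional
`W(u) = ‖u‖_{L²}^{(4σ-1)/σ} ‖|∇|^σ u‖_{L²}^{1/σ} / ‖u‖_{L⁴}⁴` (meaningful for `0 ≠ u ∈ H^σ`). -/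
noncomputable def weinsteinW (σ : ℝ) (u : L2R) : ℝ :=
  ‖u‖ ^ ((4 * σ - 1) / σ) * ‖fracDeriv σ u‖ ^ (1 / σ) /
    (eLpNorm u 4 (volume : Measure ℝ)).toReal ^ 4

/-- `Q` is a minimizer of `W` over the nonzero elements of `H^σ(ℝ; ℂ)`. -/
def IsWeinsteinMinimizer (σ : ℝ) (Q : L2R) : Prop :=
  Q ∈ SobolevH σ ∧ Q ≠ 0 ∧ ∀ u ∈ SobolevH σ, u ≠ 0 → weinsteinW σ Q ≤ weinsteinW σ u

/-- `Q ∈ H^σ` is a weak solution of `(-Δ)^σ Q + Q - Q³ = 0`: the equation holds when paired with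
every `v ∈ H^σ`, where `(-Δ)^σ Q ∈ H^{-σ}` acts by
`⟨(-Δ)^σ Q, v⟩ = ∫ |2πξ|^{2σ} Q̂(ξ) conj (v̂(ξ)) dξ`. -/
def IsGroundStateSolution (σ : ℝ) (Q : L2R) : Prop :=
  Q ∈ SobolevH σ ∧ ∀ v ∈ SobolevH σ,
    (∫ ξ : ℝ, ((|2 * Real.pi * ξ| ^ (2 * σ) : ℝ) : ℂ) * (𝓕 Q : L2R) ξ * conj ((𝓕 v : L2R) ξ))
      + (∫ x : ℝ, Q x * conj (v x)) - (∫ x : ℝ, (Q x) ^ 3 * conj (v x)) = 0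

/-! The operator `besselOp σ` carries `L²` isometrically onto `H^σ` with the norm `‖u‖² + ‖|∇|^σ
u‖²`. Everything reduces to one problem for the embedding `H^σ → L⁴`: maximize `quartic σ g =
‖besselOp σ g‖_{L⁴}⁴` over the unit ball of `L²`. The embedding is bounded because the multiplier
`(1 + |2πξ|^{2σ})^{-1/2}` lies in `L⁴` when `σ > 1/4` (`eLpNorm_fourierInv_mulOp_le`).

A maximizer exists (`exists_quartic_maximizer`) although translations destroy compactness. A
near-maximizer has a low-frequency part that is large at some point
(`exists_le_norm_inner_lowKernel`). Translating that point to the origin makes the weak limit `g` of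
a maximizing sequence nonzero. Since multiplication by a fixed `L² ∩ L⁴` function is compact from
`H^σ` to `L²` (`tendsto_integral_norm_sq_mul_besselOp`), the `L⁴` norm splits as in Brezis–Lieb.
With `S` the supremum and `t = ‖g‖²`, this gives `S ≤ S t² + S (1 - t)²`. As `0 < t ≤ 1`, it forces
`t = 1`, and then `g` is a maximizer.

The real or the imaginary part of a maximizer is, once normalized, again a maximizer
(`exists_real_quartic_maximizer`). The first variation gives `S ⟨u, v⟩_{H^σ} = ∫ u³ v̄` for real
`u`, and multiplying `u` by `S^{-1/2}` turns this into the ground state equation.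

The same function minimizes `W`. Optimizing the embedding over dilations yields a
Gagliardo–Nirenberg inequality (`quartic_le_of_forall_le`), and weighted AM–GM (`four_mul_rpow_le`)
shows that maximizers of the embedding attain its constant. No dilation of the maximizer is needed,
because the chosen `H^σ` norm already has the coefficients of the equation. -/

open Filter Topology

/-! ### The `L²` Fourier transform through truncated integrals, and its symmetries. -/

section FourierL2

theorem L2R.norm_sq_eq_integral (u : L2R) : ‖u‖ ^ 2 = ∫ x, ‖u x‖ ^ 2 := by
  have h := @inner_self_eq_norm_sq_to_K ℂ L2R _ _ _ u
  rw [L2.inner_def] at h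
  simp only [inner_self_eq_norm_sq_to_K] at h
  have h2 : ((∫ x, ‖u x‖ ^ 2 : ℝ) : ℂ) = ((‖u‖ ^ 2 : ℝ) : ℂ) := by
    rw [← integral_complex_ofReal]
    push_cast
    exact h
  exact_mod_cast h2.symm

theorem L2R.integrable_norm_sq (u : L2R) : Integrable fun x ↦ ‖u x‖ ^ 2 :=
  (memLp_two_iff_integrable_sq_norm (Lp.aestronglyMeasurable u)).1 (Lp.memLp u)

theorem L2R.norm_toLp_sq {f : ℝ → ℂ} (hf : MemLp f 2 (volume : Measure ℝ)) :
    ‖hf.toLp f‖ ^ 2 = ∫ x, ‖f x‖ ^ 2 := by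
  rw [L2R.norm_sq_eq_integral]
  refine integral_congr_ae ?_
  filter_upwards [hf.coeFn_toLp] with x hx
  rw [hx]

theorem L2R.tendsto_of_dominated {F : ℕ → L2R} {f : L2R}
    (hdom : ∀ n, ∀ᵐ x, ‖F n x - f x‖ ≤ ‖f x‖)
    (hlim : ∀ᵐ x, Tendsto (fun n ↦ F n x) atTop (𝓝 (f x))) : Tendsto F atTop (𝓝 f) := by
  rw [tendsto_iff_norm_sub_tendsto_zero]
  have h : Tendsto (fun n ↦ ‖F n - f‖ ^ 2) atTop (𝓝 0) := by
    have h1 : ∀ n, ‖F n - f‖ ^ 2 = ∫ x, ‖F n x - f x‖ ^ 2 := fun n ↦ by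
      rw [L2R.norm_sq_eq_integral]
      refine integral_congr_ae ?_
      filter_upwards [Lp.coeFn_sub (F n) f] with x hx
      rw [hx, Pi.sub_apply]
    simp_rw [h1]
    have h0 : (0 : ℝ) = ∫ _ : ℝ, (0 : ℝ) := by simp
    rw [h0]
    refine tendsto_integral_of_dominated_convergence (fun x ↦ ‖f x‖ ^ 2) (fun n ↦ ?_)
      f.integrable_norm_sq (fun n ↦ ?_) ?_
    · exact (((Lp.aestronglyMeasurable (F n)).sub (Lp.aestronglyMeasurable f)).norm.pow 2)
    · filter_upwards [hdom n] with x hx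
      rw [Real.norm_of_nonneg (by positivity)]
      gcongr
    · filter_upwards [hlim] with x hx
      have := ((tendsto_iff_norm_sub_tendsto_zero.1 hx).pow 2)
      simpa using this
  have := (Real.continuous_sqrt.tendsto 0).comp h
  simpa [Function.comp_def] using this

theorem L2R.exists_subseq_ae_tendsto {F : ℕ → L2R} {f : L2R} (h : Tendsto F atTop (𝓝 f)) :
    ∃ φ : ℕ → ℕ, StrictMono φ ∧ ∀ᵐ x, Tendsto (fun n ↦ F (φ n) x) atTop (𝓝 (f x)) :=
  (tendstoInMeasure_of_tendsto_Lp h).exists_seq_tendsto_ae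

theorem continuous_fourierInv_of_integrable {f : ℝ → ℂ} (hf : Integrable f) :
    Continuous (𝓕⁻ f : ℝ → ℂ) :=
  VectorFourier.fourierIntegral_continuous Real.continuous_fourierChar
    ((innerSL ℝ).continuous₂.neg) hf

/-- Both sides define the same distribution: against a smooth compactly supported function, the `L²`
transform moves onto the test function by the definition for tempered distributions, and the
integral by Fubini. -/
theorem fourierInv_toLp_ae_eq {f : ℝ → ℂ} (h1 : Integrable f) (h2 : MemLp f 2) :
    (𝓕⁻ (h2.toLp f : L2R) : L2R) =ᵐ[volume] (𝓕⁻ f : ℝ → ℂ) := by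
  have hc : Continuous (𝓕⁻ f : ℝ → ℂ) := continuous_fourierInv_of_integrable h1
  refine ae_eq_of_integral_contDiff_smul_eq
    ((Lp.memLp _).locallyIntegrable one_le_two) hc.locallyIntegrable ?_
  intro g g_smooth g_cpt
  have hg₁ : HasCompactSupport (Complex.ofRealCLM ∘ g) := g_cpt.comp_left rfl
  have hg₂ : ContDiff ℝ ((⊤ : ℕ∞) : WithTop ℕ∞) (Complex.ofRealCLM ∘ g) := by fun_prop
  set G : 𝓢(ℝ, ℂ) := hg₁.toSchwartzMap hg₂ with hG
  have hGx : ∀ x, G x = (g x : ℂ) := fun x ↦ rfl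
  have e1 : ∫ x, g x • (𝓕⁻ (h2.toLp f : L2R) : L2R) x
      = ((𝓕⁻ (h2.toLp f : L2R) : L2R) : 𝓢'(ℝ, ℂ)) G := by
    rw [Lp.toTemperedDistribution_apply]
    simp only [hGx, Complex.real_smul, smul_eq_mul]
  have e2 : ∫ x, g x • (𝓕⁻ f : ℝ → ℂ) x = ∫ x, (𝓕⁻ f : ℝ → ℂ) x • (G : ℝ → ℂ) x := by
    simp only [hGx, Complex.real_smul, smul_eq_mul, mul_comm]
  rw [e1, e2, ← Lp.fourierInv_toTemperedDistribution_eq, TemperedDistribution.fourierInv_apply,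
    Lp.toTemperedDistribution_apply]
  have h3 := VectorFourier.integral_fourierIntegral_smul_eq_flip (μ := (volume : Measure ℝ))
    (ν := (volume : Measure ℝ)) (L := -innerₗ ℝ) Real.continuous_fourierChar
    (by exact (innerSL ℝ).continuous₂.neg) h1 (G.integrable)
  have hflip : (-innerₗ ℝ).flip = -innerₗ ℝ := by
    ext; simp
  rw [hflip] at h3
  refine Eq.trans ?_ h3.symm
  refine integral_congr_ae ?_
  filter_upwards [h2.coeFn_toLp] with x hx
  rw [hx, smul_eq_mul, smul_eq_mul, mul_comm, SchwartzMap.fourierInv_coe]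
  rfl

/-- The truncated inverse Fourier integral `∫_{-a}^{a} e^{2πixξ} f(ξ) dξ`. -/
noncomputable def truncFourierInv (a : ℝ) (f : ℝ → ℂ) (x : ℝ) : ℂ :=
  ∫ ξ in (-a)..a, Complex.exp ((2 * Real.pi * ξ * x : ℝ) * Complex.I) * f ξ

theorem memLp_indicator_L2R (f : L2R) {s : Set ℝ} (hs : MeasurableSet s) :
    MemLp (s.indicator f) 2 (volume : Measure ℝ) := (Lp.memLp f).indicator hs

theorem integrable_indicator_L2R (f : L2R) {s : Set ℝ} (hs : MeasurableSet s)
    (hfin : volume s ≠ ∞) : Integrable (s.indicator f) := by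
  rw [integrable_indicator_iff hs]
  have : IsFiniteMeasure (volume.restrict s) := ⟨by simpa using hfin.lt_top⟩
  exact ((Lp.memLp f).restrict s).integrable one_le_two

theorem fourierInv_indicator_eq_truncFourierInv {a : ℝ} (ha : 0 ≤ a) (f : ℝ → ℂ) (x : ℝ) :
    (𝓕⁻ ((Set.Ioc (-a) a).indicator f) : ℝ → ℂ) x = truncFourierInv a f x := by
  rw [Real.fourierInv_eq', truncFourierInv, intervalIntegral.integral_of_le (by linarith),
    ← integral_indicator measurableSet_Ioc]
  congr 1
  ext ξ
  by_cases h : ξ ∈ Set.Ioc (-a) a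
  · simp only [Set.indicator_of_mem h, smul_eq_mul]
    congr 3
    simp [mul_comm, mul_left_comm, mul_assoc]
  · simp [Set.indicator_of_notMem h]

theorem fourierInv_toLp_indicator_ae_eq {a : ℝ} (ha : 0 ≤ a) (f : L2R) :
    (𝓕⁻ ((memLp_indicator_L2R f (measurableSet_Ioc (a := -a) (b := a))).toLp _ : L2R) : L2R)
      =ᵐ[volume] truncFourierInv a f := by
  filter_upwards [fourierInv_toLp_ae_eq (integrable_indicator_L2R f
    (measurableSet_Ioc (a := -a) (b := a)) (by simp))
    (memLp_indicator_L2R f measurableSet_Ioc)] with x hx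
  rw [hx, fourierInv_indicator_eq_truncFourierInv ha]

theorem exists_subseq_truncFourierInv_tendsto (f : L2R) {a : ℕ → ℝ} (ha0 : ∀ n, 0 ≤ a n)
    (ha : Tendsto a atTop atTop) : ∃ φ : ℕ → ℕ, StrictMono φ ∧ ∀ᵐ x,
      Tendsto (fun j ↦ truncFourierInv (a (φ j)) f x) atTop (𝓝 ((𝓕⁻ f : L2R) x)) := by
  set F : ℕ → L2R := fun n ↦
    (memLp_indicator_L2R f (measurableSet_Ioc (a := -(a n)) (b := a n))).toLp _ with hF
  have hFx : ∀ n, F n =ᵐ[volume] (Set.Ioc (-(a n)) (a n)).indicator f := fun n ↦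
    MemLp.coeFn_toLp _
  have hlim : Tendsto F atTop (𝓝 f) := by
    refine L2R.tendsto_of_dominated (fun n ↦ ?_) ?_
    · filter_upwards [hFx n] with x hx
      rw [hx]
      by_cases h : x ∈ Set.Ioc (-(a n)) (a n)
      · simp [Set.indicator_of_mem h]
      · simp [Set.indicator_of_notMem h]
    · filter_upwards [ae_all_iff.2 hFx] with x hx
      refine tendsto_const_nhds.congr' ?_
      filter_upwards [ha.eventually_gt_atTop |x|] with n hn
      rw [hx n, Set.indicator_of_mem]
      exact ⟨(abs_lt.1 hn).1, (abs_lt.1 hn).2.le⟩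
  have hlim' : Tendsto (fun n ↦ (𝓕⁻ (F n) : L2R)) atTop (𝓝 (𝓕⁻ f : L2R)) :=
    ((FourierTransform.fourierInvCLM ℂ L2R).continuous.tendsto f).comp hlim
  obtain ⟨φ, hφ, h⟩ := L2R.exists_subseq_ae_tendsto hlim'
  refine ⟨φ, hφ, ?_⟩
  filter_upwards [h, ae_all_iff.2 fun n ↦ fourierInv_toLp_indicator_ae_eq (ha0 n) f] with x hx h2
  refine hx.congr fun j ↦ ?_
  rw [← h2 (φ j)]

/-- Transfers an identity between truncated inverse Fourier integrals of `h` and `f` to the `L²`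
inverse Fourier transforms. -/
theorem fourierInv_ae_eq_of_truncFourierInv (f h : L2R) {τ : ℝ → ℝ}
    (hτ : Measure.QuasiMeasurePreserving τ volume volume) {Φ : ℂ → ℂ} (hΦ : Continuous Φ)
    {c : ℝ} (hc : 0 < c)
    (H : ∀ a, 0 ≤ a → ∀ x, truncFourierInv (c * a) h x = Φ (truncFourierInv a f (τ x))) :
    ∀ᵐ x, (𝓕⁻ h : L2R) x = Φ ((𝓕⁻ f : L2R) (τ x)) := by
  obtain ⟨φ, hφ, h1⟩ := exists_subseq_truncFourierInv_tendsto f (a := fun n ↦ (n : ℝ))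
    (fun n ↦ n.cast_nonneg) tendsto_natCast_atTop_atTop
  -- Extracting the second subsequence from the first gives a.e. convergence for `f` and `h` along
  -- common cutoffs.
  obtain ⟨ψ, hψ, h2⟩ := exists_subseq_truncFourierInv_tendsto h (a := fun n ↦ c * (φ n : ℝ))
    (fun n ↦ by positivity)
    ((tendsto_natCast_atTop_atTop.comp hφ.tendsto_atTop).const_mul_atTop hc)
  filter_upwards [hτ.ae h1, h2] with x hx1 hx2
  refine tendsto_nhds_unique hx2 ?_
  have := (hΦ.tendsto _).comp (hx1.comp hψ.tendsto_atTop)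
  refine this.congr fun j ↦ ?_
  exact (H _ (Nat.cast_nonneg _) x).symm

theorem quasiMeasurePreserving_affine {b : ℝ} (hb : b ≠ 0) (y : ℝ) :
    Measure.QuasiMeasurePreserving (fun x : ℝ ↦ b * x + y) volume volume := by
  have h1 : Measure.QuasiMeasurePreserving (fun x : ℝ ↦ b * x) volume volume := by
    refine ⟨by fun_prop, ?_⟩
    rw [Real.map_volume_mul_left hb]
    exact Measure.smul_absolutelyContinuous
  exact (measurePreserving_add_right volume y).quasiMeasurePreserving.comp h1

theorem fourierInv_modulation (f h : L2R) (y : ℝ)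
    (hh : ∀ᵐ ξ, h ξ = Complex.exp ((2 * Real.pi * ξ * y : ℝ) * Complex.I) * f ξ) :
    ∀ᵐ x, (𝓕⁻ h : L2R) x = (𝓕⁻ f : L2R) (x + y) := by
  have := fourierInv_ae_eq_of_truncFourierInv f h
    (quasiMeasurePreserving_affine one_ne_zero y) (Φ := id) continuous_id one_pos ?_
  · simpa using this
  · intro a ha x
    simp only [truncFourierInv, one_mul, id]
    refine intervalIntegral.integral_congr_ae ?_
    filter_upwards [hh] with ξ hξ _
    rw [hξ, ← mul_assoc, ← Complex.exp_add]
    congr 2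
    push_cast
    ring

theorem fourierInv_dilation (f h : L2R) {b : ℝ} (hb : 0 < b)
    (hh : ∀ᵐ ξ, h ξ = (b⁻¹ : ℝ) * f (b⁻¹ * ξ)) :
    ∀ᵐ x, (𝓕⁻ h : L2R) x = (𝓕⁻ f : L2R) (b * x) := by
  have := fourierInv_ae_eq_of_truncFourierInv f h
    (quasiMeasurePreserving_affine hb.ne' 0) (Φ := id) continuous_id hb ?_
  · simpa using this
  · intro a ha x
    simp only [truncFourierInv, id]
    have e : ∫ ξ in (-(b * a))..(b * a), Complex.exp ((2 * Real.pi * ξ * x : ℝ) * Complex.I) * h ξ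
        = ∫ ξ in (-(b * a))..(b * a), (b⁻¹ : ℝ) • (fun η : ℝ ↦
          Complex.exp ((2 * Real.pi * η * (b * x + 0) : ℝ) * Complex.I) * f η) (b⁻¹ * ξ) := by
      refine intervalIntegral.integral_congr_ae ?_
      filter_upwards [hh] with ξ hξ _
      rw [hξ, Complex.real_smul]
      have : 2 * Real.pi * (b⁻¹ * ξ) * (b * x + 0) = 2 * Real.pi * ξ * x := by
        field_simp
        ring
      simp only [this]
      ring
    rw [e, intervalIntegral.integral_smul, intervalIntegral.integral_comp_mul_left
      (fun η : ℝ ↦ Complex.exp ((2 * Real.pi * η * (b * x + 0) : ℝ) * Complex.I) * f η)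
      (inv_ne_zero hb.ne'), smul_smul, mul_inv_cancel₀ (inv_ne_zero hb.ne'), one_smul]
    congr 1 <;> field_simp

theorem fourierInv_conj_neg (f h : L2R) (hh : ∀ᵐ ξ, h ξ = conj (f (-ξ))) :
    ∀ᵐ x, (𝓕⁻ h : L2R) x = conj ((𝓕⁻ f : L2R) x) := by
  have := fourierInv_ae_eq_of_truncFourierInv f h
    (quasiMeasurePreserving_affine one_ne_zero 0) (Φ := conj) Complex.continuous_conj one_pos ?_
  · simpa using this
  · intro a ha x
    simp only [truncFourierInv, one_mul, add_zero]
    have e : ∫ ξ in (-a)..a, Complex.exp ((2 * Real.pi * ξ * x : ℝ) * Complex.I) * h ξ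
        = ∫ ξ in (-a)..a, (fun η : ℝ ↦
          conj (Complex.exp ((2 * Real.pi * η * x : ℝ) * Complex.I) * f η)) (-ξ) := by
      refine intervalIntegral.integral_congr_ae ?_
      filter_upwards [hh] with ξ hξ _
      simp only [hξ, map_mul, ← Complex.exp_conj, Complex.conj_ofReal, Complex.conj_I]
      congr 2
      push_cast
      ring
    rw [e, intervalIntegral.integral_comp_neg (fun η : ℝ ↦
        conj (Complex.exp ((2 * Real.pi * η * x : ℝ) * Complex.I) * f η)), neg_neg,
      intervalIntegral.integral_of_le (by linarith), intervalIntegral.integral_of_le (by linarith),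
      integral_conj]

end FourierL2

/-! ### Fourier multipliers with symbol in `L⁴` map `L²` to `L⁴`. -/

section Multiplier

/-- Multiplication by a bounded function on `L²`. -/
noncomputable def mulOp (k : ℝ → ℂ) (hk : MemLp k ∞ (volume : Measure ℝ)) : L2R →L[ℂ] L2R :=
  (ContinuousLinearMap.mul ℂ ℂ).holderL volume ∞ 2 2 (hk.toLp k)

theorem mulOp_ae {k : ℝ → ℂ} (hk : MemLp k ∞ (volume : Measure ℝ)) (g : L2R) :
    ∀ᵐ x, mulOp k hk g x = k x * g x := by
  filter_upwards [(ContinuousLinearMap.mul ℂ ℂ).coeFn_holder (r := 2) (hk.toLp k) g,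
    hk.coeFn_toLp] with x h1 h2
  have : mulOp k hk g = (ContinuousLinearMap.mul ℂ ℂ).holder 2 (hk.toLp k) g := rfl
  rw [this, h1, h2]
  rfl

theorem lintegral_mul_sq_le {α : Type*} [MeasurableSpace α] {μ : Measure α} {f g : α → ℝ≥0∞}
    (hf : AEMeasurable f μ) (hg : AEMeasurable g μ) :
    (∫⁻ x, f x * g x ∂μ) ^ 2 ≤ (∫⁻ x, f x ^ 2 ∂μ) * ∫⁻ x, g x ^ 2 ∂μ := by
  have h := ENNReal.lintegral_mul_le_Lp_mul_Lq μ (p := 2) (q := 2)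
    (by constructor <;> norm_num) hf hg
  simp only [Pi.mul_apply] at h
  have h2 := pow_le_pow_left₀ (zero_le) h 2
  rw [mul_pow] at h2
  refine h2.trans (le_of_eq ?_)
  have e : ∀ a : ℝ≥0∞, (a ^ (1 / 2 : ℝ)) ^ 2 = a := fun a ↦ by
    rw [← ENNReal.rpow_natCast, ← ENNReal.rpow_mul]; norm_num
  rw [e, e]
  simp

theorem eLpNorm_four_pow (f : ℝ → ℂ) :
    eLpNorm f 4 (volume : Measure ℝ) ^ 4 = ∫⁻ x, ‖f x‖ₑ ^ 4 := by
  have h := eLpNorm_nnreal_pow_eq_lintegral (f := f) (μ := (volume : Measure ℝ)) (p := 4)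
    (by norm_num)
  have e : ((4 : NNReal) : ℝ) = ((4 : ℕ) : ℝ) := by norm_num
  rw [e] at h
  simp only [ENNReal.rpow_natCast] at h
  exact_mod_cast h

theorem eLpNorm_two_pow (f : ℝ → ℂ) :
    eLpNorm f 2 (volume : Measure ℝ) ^ 2 = ∫⁻ x, ‖f x‖ₑ ^ 2 := by
  have h := eLpNorm_nnreal_pow_eq_lintegral (f := f) (μ := (volume : Measure ℝ)) (p := 2)
    (by norm_num)
  have e : ((2 : NNReal) : ℝ) = ((2 : ℕ) : ℝ) := by norm_num
  rw [e] at h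
  simp only [ENNReal.rpow_natCast] at h
  exact_mod_cast h

/-- Cauchy–Schwarz in `t` separates `k(t) k(ξ - t)` from `g(t) g(ξ - t)`. A second Cauchy–Schwarz
bounds the `k` factor by `‖k‖₄⁴` uniformly in `ξ`; by Tonelli the `g` factor integrates to `‖g‖₂⁴`.
-/
theorem lintegral_convolution_sq_le {k g : ℝ → ℂ} (hk : AEStronglyMeasurable k volume)
    (hg : AEStronglyMeasurable g volume) :
    ∫⁻ ξ, (∫⁻ t, ‖k t * g t‖ₑ * ‖k (ξ - t) * g (ξ - t)‖ₑ) ^ 2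
      ≤ (∫⁻ t, ‖k t‖ₑ ^ 4) * (∫⁻ t, ‖g t‖ₑ ^ 2) ^ 2 := by
  have hk' := hk.enorm
  have hg' := hg.enorm
  have hq : ∀ ξ : ℝ, Measure.QuasiMeasurePreserving (fun t : ℝ ↦ ξ - t) volume volume := fun ξ ↦
    (Measure.measurePreserving_sub_left volume ξ).quasiMeasurePreserving
  have hkξ : ∀ ξ : ℝ, AEMeasurable (fun t ↦ ‖k (ξ - t)‖ₑ) volume := fun ξ ↦
    hk'.comp_quasiMeasurePreserving (hq ξ)
  have hgξ : ∀ ξ : ℝ, AEMeasurable (fun t ↦ ‖g (ξ - t)‖ₑ) volume := fun ξ ↦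
    hg'.comp_quasiMeasurePreserving (hq ξ)
  have h1 : ∀ ξ : ℝ, (∫⁻ t, ‖k t * g t‖ₑ * ‖k (ξ - t) * g (ξ - t)‖ₑ) ^ 2
      ≤ (∫⁻ t, ‖k t‖ₑ ^ 4) * ∫⁻ t, ‖g t‖ₑ ^ 2 * ‖g (ξ - t)‖ₑ ^ 2 := by
    intro ξ
    have e1 : ∫⁻ t, ‖k t * g t‖ₑ * ‖k (ξ - t) * g (ξ - t)‖ₑ
        = ∫⁻ t, (‖k t‖ₑ * ‖k (ξ - t)‖ₑ) * (‖g t‖ₑ * ‖g (ξ - t)‖ₑ) := by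
      refine lintegral_congr fun t ↦ ?_
      rw [enorm_mul, enorm_mul]
      ring
    rw [e1]
    refine (lintegral_mul_sq_le (hk'.mul (hkξ ξ)) (hg'.mul (hgξ ξ))).trans ?_
    have e2 : ∫⁻ t, (‖g t‖ₑ * ‖g (ξ - t)‖ₑ) ^ 2 = ∫⁻ t, ‖g t‖ₑ ^ 2 * ‖g (ξ - t)‖ₑ ^ 2 :=
      lintegral_congr fun t ↦ mul_pow _ _ _
    have e3 : ∫⁻ t, (‖k t‖ₑ * ‖k (ξ - t)‖ₑ) ^ 2 = ∫⁻ t, ‖k t‖ₑ ^ 2 * ‖k (ξ - t)‖ₑ ^ 2 :=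
      lintegral_congr fun t ↦ mul_pow _ _ _
    simp only [Pi.mul_apply]
    rw [e2, e3]
    refine mul_le_mul_left ?_ _
    have h2 : (∫⁻ t, ‖k t‖ₑ ^ 2 * ‖k (ξ - t)‖ₑ ^ 2) ^ 2
        ≤ (∫⁻ t, (‖k t‖ₑ ^ 2) ^ 2) * ∫⁻ t, (‖k (ξ - t)‖ₑ ^ 2) ^ 2 :=
      lintegral_mul_sq_le (hk'.pow_const 2) ((hkξ ξ).pow_const 2)
    have e4 : ∀ a : ℝ≥0∞, (a ^ 2) ^ 2 = a ^ 4 := fun a ↦ by ring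
    simp only [e4] at h2
    rw [lintegral_sub_left_eq_self (fun t ↦ ‖k t‖ₑ ^ 4) ξ, ← sq] at h2
    exact (ENNReal.pow_le_pow_left_iff two_ne_zero).1 h2
  refine (lintegral_mono h1).trans ?_
  have hm1 : AEMeasurable (fun p : ℝ × ℝ ↦ ‖g p.2‖ₑ ^ 2) (volume.prod volume) :=
    (hg'.pow_const 2).comp_quasiMeasurePreserving Measure.quasiMeasurePreserving_snd
  have hm2 : AEMeasurable (fun p : ℝ × ℝ ↦ ‖g (p.1 - p.2)‖ₑ ^ 2) (volume.prod volume) :=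
    (hg'.pow_const 2).comp_quasiMeasurePreserving (quasiMeasurePreserving_sub volume volume)
  have hm : AEMeasurable (Function.uncurry fun ξ t : ℝ ↦ ‖g t‖ₑ ^ 2 * ‖g (ξ - t)‖ₑ ^ 2)
      (volume.prod volume) := hm1.mul hm2
  have hm3 : AEMeasurable (fun ξ : ℝ ↦ ∫⁻ t, ‖g t‖ₑ ^ 2 * ‖g (ξ - t)‖ₑ ^ 2) volume :=
    hm.lintegral_prod_right'
  rw [lintegral_const_mul'' _ hm3]
  refine mul_le_mul_right (le_of_eq ?_) _
  rw [lintegral_lintegral_swap hm]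
  have h3 : ∀ t : ℝ, ∫⁻ ξ, ‖g t‖ₑ ^ 2 * ‖g (ξ - t)‖ₑ ^ 2 = ‖g t‖ₑ ^ 2 * ∫⁻ s, ‖g s‖ₑ ^ 2 := by
    intro t
    have hm4 : AEMeasurable (fun ξ : ℝ ↦ ‖g (ξ - t)‖ₑ ^ 2) volume :=
      (hg'.pow_const 2).comp_quasiMeasurePreserving
        (measurePreserving_sub_right volume t).quasiMeasurePreserving
    rw [lintegral_const_mul'' _ hm4, lintegral_sub_right_eq_self (fun s ↦ ‖g s‖ₑ ^ 2) t]
  simp_rw [h3]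
  rw [lintegral_mul_const'' _ (hg'.pow_const 2), sq]

/-- The exponent 4 is even: with `f = k G` and `u = 𝓕⁻ f`, one has `‖u‖₄⁴ = ‖u²‖₂² = ‖f ∗ f‖₂²` by
Plancherel. Taking `G` Schwartz makes `f` integrable, so that the convolution theorem applies. -/
theorem eLpNorm_fourierInv_mulOp_toLp_le {k : ℝ → ℂ} (hk : MemLp k ∞ (volume : Measure ℝ))
    (hk4 : MemLp k 4 (volume : Measure ℝ)) (G : 𝓢(ℝ, ℂ)) :
    eLpNorm (𝓕⁻ (mulOp k hk (G.toLp 2)) : L2R) 4 volume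
      ≤ eLpNorm k 4 volume * eLpNorm (G.toLp 2 : L2R) 2 volume := by
  set f : ℝ → ℂ := fun x ↦ k x * G x with hf
  have hfi : Integrable f := by
    have := (G.memLp 1 volume).mul (r := 1) hk
    exact memLp_one_iff_integrable.1 this
  have hf2 : MemLp f 2 volume := (G.memLp 2 volume).mul (r := 2) hk
  have hop : mulOp k hk (G.toLp 2) = hf2.toLp f := by
    apply Lp.ext
    filter_upwards [mulOp_ae hk (G.toLp 2), hf2.coeFn_toLp, G.coeFn_toLp 2 volume] with x h1 h2 h3
    rw [h1, h2, h3]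
  have hu := fourierInv_toLp_ae_eq hfi hf2
  rw [← hop] at hu
  set F : ℝ → ℂ := convolution f f (ContinuousLinearMap.mul ℂ ℂ) volume with hF
  have hFi : Integrable F := hfi.integrable_convolution _ hfi
  have hFsq : ∀ x, (𝓕⁻ F : ℝ → ℂ) x = (𝓕⁻ f : ℝ → ℂ) x ^ 2 := fun x ↦ by
    rw [Real.fourierInv_eq_fourier_neg, Real.fourierInv_eq_fourier_neg,
      Real.fourier_mul_convolution_eq hfi hfi, sq]
  have hFb : ∫⁻ ξ, ‖F ξ‖ₑ ^ 2 ≤ (∫⁻ t, ‖k t‖ₑ ^ 4) * (∫⁻ t, ‖G t‖ₑ ^ 2) ^ 2 := by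
    refine le_trans (lintegral_mono fun ξ ↦ ?_)
      (lintegral_convolution_sq_le hk.1 (G.memLp 2 volume).1)
    refine pow_le_pow_left₀ zero_le ?_ 2
    refine (enorm_integral_le_lintegral_enorm _).trans (le_of_eq (lintegral_congr fun t ↦ ?_))
    simp [hf, enorm_mul]
  have hG2 : eLpNorm (G.toLp 2 : L2R) 2 volume = eLpNorm G 2 volume :=
    eLpNorm_congr_ae (G.coeFn_toLp 2 volume)
  have hFb' : eLpNorm F 2 volume ^ 2 ≤ (eLpNorm k 4 volume * eLpNorm G 2 volume) ^ 4 := by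
    rw [eLpNorm_two_pow, mul_pow, eLpNorm_four_pow]
    have : eLpNorm G 2 volume ^ 4 = (∫⁻ t, ‖G t‖ₑ ^ 2) ^ 2 := by
      rw [← eLpNorm_two_pow]; ring
    rw [this]
    exact hFb
  have hF2 : MemLp F 2 volume := by
    refine ⟨hFi.1, ?_⟩
    have : eLpNorm F 2 volume ^ 2 < ∞ := lt_of_le_of_lt hFb'
      (ENNReal.pow_lt_top (ENNReal.mul_lt_top hk4.2 (G.memLp 2 volume).2))
    by_contra hcon
    rw [not_lt, top_le_iff] at hcon
    simp [hcon] at this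
  have hFu := fourierInv_toLp_ae_eq hFi hF2
  have hnorm : eLpNorm (𝓕⁻ (hF2.toLp F) : L2R) 2 volume = eLpNorm F 2 volume := by
    rw [← eLpNorm_congr_ae hF2.coeFn_toLp]
    have h1 : ‖(𝓕⁻ (hF2.toLp F) : L2R)‖ = ‖hF2.toLp F‖ := by
      rw [← Lp.norm_fourier_eq, FourierTransform.fourier_fourierInv_eq]
    rw [Lp.norm_def, Lp.norm_def] at h1
    exact (ENNReal.toReal_eq_toReal_iff' (Lp.eLpNorm_ne_top _) (Lp.eLpNorm_ne_top _)).1 h1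
  rw [hG2]
  refine (ENNReal.pow_le_pow_left_iff four_ne_zero).1 (le_trans (le_of_eq ?_) hFb')
  rw [← hnorm, eLpNorm_four_pow, eLpNorm_two_pow]
  refine lintegral_congr_ae ?_
  filter_upwards [hu, hFu] with x h1 h2
  rw [h1, h2, hFsq, enorm_pow, ← pow_mul]

/-- The `L² → L⁴` bound for the multiplier `g ↦ 𝓕⁻ (k g)` with `k ∈ L⁴`. -/
theorem eLpNorm_fourierInv_mulOp_le {k : ℝ → ℂ} (hk : MemLp k ∞ (volume : Measure ℝ))
    (hk4 : MemLp k 4 (volume : Measure ℝ)) (g : L2R) :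
    eLpNorm (𝓕⁻ (mulOp k hk g) : L2R) 4 volume ≤ eLpNorm k 4 volume * eLpNorm g 2 volume := by
  have hd : g ∈ closure (Set.range (SchwartzMap.toLpCLM ℂ ℂ 2 (volume : Measure ℝ))) :=
    SchwartzMap.denseRange_toLpCLM (p := 2) ENNReal.ofNat_ne_top g
  obtain ⟨v, hv, hlim⟩ := mem_closure_iff_seq_limit.1 hd
  choose G hG using hv
  have hlim' : Tendsto (fun n ↦ (𝓕⁻ (mulOp k hk (v n)) : L2R)) atTop
      (𝓝 (𝓕⁻ (mulOp k hk g) : L2R)) :=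
    (((FourierTransform.fourierInvCLM ℂ L2R).continuous.comp (mulOp k hk).continuous).tendsto
      g).comp hlim
  obtain ⟨φ, hφ, hae⟩ := L2R.exists_subseq_ae_tendsto hlim'
  -- Convergence is known only in `L²`; Fatou along an a.e. convergent subsequence carries the `L⁴`
  -- bound to the limit.
  refine (Lp.eLpNorm_lim_le_liminf_eLpNorm (fun n ↦ Lp.aestronglyMeasurable _) _ hae).trans ?_
  have hb : ∀ n, eLpNorm (𝓕⁻ (mulOp k hk (v (φ n))) : L2R) 4 volume
      ≤ eLpNorm k 4 volume * ‖v (φ n)‖ₑ := fun n ↦ by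
    rw [← hG (φ n), Lp.enorm_def]
    exact eLpNorm_fourierInv_mulOp_toLp_le hk hk4 (G (φ n))
  have ht : Tendsto (fun n ↦ eLpNorm k 4 volume * ‖v (φ n)‖ₑ) atTop
      (𝓝 (eLpNorm k 4 volume * ‖g‖ₑ)) :=
    ENNReal.Tendsto.const_mul ((continuous_enorm.tendsto g).comp (hlim.comp hφ.tendsto_atTop))
      (Or.inr hk4.2.ne)
  rw [← Lp.enorm_def, ← ht.liminf_eq]
  exact liminf_le_liminf (Eventually.of_forall hb)

end Multiplier

/-! ### The parametrization of `H^σ` by `L²` and its frequency pieces. -/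

section BesselType

/-- The weight `√(1 + |2πξ|^{2σ})`; the norm `‖√(1 + |2πξ|^{2σ}) û‖_{L²}` is the natural Hilbert
norm on `H^σ`. -/
noncomputable def sobolevWeight (σ ξ : ℝ) : ℝ := √(1 + |2 * Real.pi * ξ| ^ (2 * σ))

theorem one_le_sobolevWeight (σ ξ : ℝ) : 1 ≤ sobolevWeight σ ξ := by
  rw [sobolevWeight, Real.one_le_sqrt]
  linarith [Real.rpow_nonneg (abs_nonneg (2 * Real.pi * ξ)) (2 * σ)]

theorem sobolevWeight_pos (σ ξ : ℝ) : 0 < sobolevWeight σ ξ :=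
  one_pos.trans_le (one_le_sobolevWeight σ ξ)

theorem sobolevWeight_sq (σ ξ : ℝ) :
    sobolevWeight σ ξ ^ 2 = 1 + |2 * Real.pi * ξ| ^ (2 * σ) :=
  Real.sq_sqrt (by positivity)

theorem sobolevWeight_neg (σ ξ : ℝ) : sobolevWeight σ (-ξ) = sobolevWeight σ ξ := by
  simp [sobolevWeight]

@[fun_prop]
theorem measurable_sobolevWeight (σ : ℝ) : Measurable (sobolevWeight σ) := by
  unfold sobolevWeight
  fun_prop

/-- Subadditivity of `t ↦ t^σ` for `0 ≤ σ ≤ 1`. This compares the homogeneous weight with the Bessel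
weight that defines `SobolevH`. -/
theorem one_add_sq_rpow_le_sobolevWeight_sq {σ : ℝ} (h0 : 0 ≤ σ) (h1 : σ ≤ 1) (ξ : ℝ) :
    (1 + ‖ξ‖ ^ 2) ^ σ ≤ sobolevWeight σ ξ ^ 2 := by
  rw [sobolevWeight_sq]
  refine (Real.rpow_add_le_add_rpow zero_le_one (by positivity) h0 h1).trans ?_
  rw [Real.one_rpow, ← Real.rpow_natCast, ← Real.rpow_mul (norm_nonneg _)]
  have hpi : (1 : ℝ) ≤ 2 * Real.pi := by linarith [Real.two_le_pi]
  have : ‖ξ‖ ≤ |2 * Real.pi * ξ| := by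
    rw [abs_mul, abs_of_nonneg (by positivity : 0 ≤ 2 * Real.pi), Real.norm_eq_abs]
    exact le_mul_of_one_le_left (abs_nonneg _) hpi
  push_cast
  gcongr

/-- The multiplier `(1 + |2πξ|^{2σ})^{-1/2}`. -/
noncomputable def besselSymbol (σ ξ : ℝ) : ℂ := ((sobolevWeight σ ξ)⁻¹ : ℝ)

theorem norm_besselSymbol (σ ξ : ℝ) : ‖besselSymbol σ ξ‖ = (sobolevWeight σ ξ)⁻¹ := by
  rw [besselSymbol, Complex.norm_real, Real.norm_of_nonneg (inv_nonneg.2 (sobolevWeight_pos σ ξ).le)]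

theorem norm_besselSymbol_le_one (σ ξ : ℝ) : ‖besselSymbol σ ξ‖ ≤ 1 := by
  rw [norm_besselSymbol]
  exact inv_le_one_of_one_le₀ (one_le_sobolevWeight σ ξ)

@[fun_prop]
theorem measurable_besselSymbol (σ : ℝ) : Measurable (besselSymbol σ) := by
  unfold besselSymbol
  fun_prop

theorem memLp_top_besselSymbol (σ : ℝ) : MemLp (besselSymbol σ) ∞ (volume : Measure ℝ) :=
  memLp_top_of_bound (by fun_prop) 1 (Eventually.of_forall (norm_besselSymbol_le_one σ))

/-- The fourth power of the symbol is at most `(1 + ξ²)^{-2σ}`, which is integrable on the line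
since `4σ > 1`. -/
theorem memLp_four_besselSymbol {σ : ℝ} (hσ : 1 / 4 < σ) (hσ' : σ ≤ 1) :
    MemLp (besselSymbol σ) 4 (volume : Measure ℝ) := by
  have hi : Integrable (fun ξ : ℝ ↦ ‖besselSymbol σ ξ‖ ^ 4) := by
    have h := integrable_rpow_neg_one_add_norm_sq (E := ℝ) (μ := volume) (r := 4 * σ)
      (by simp; linarith)
    refine h.mono' (by fun_prop) (Eventually.of_forall fun ξ ↦ ?_)
    rw [norm_besselSymbol, Real.norm_of_nonneg (by have := sobolevWeight_pos σ ξ; positivity)]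
    have h1 := one_add_sq_rpow_le_sobolevWeight_sq (by linarith : 0 ≤ σ) hσ' ξ
    have h2 : (1 + ‖ξ‖ ^ 2) ^ (-(4 * σ) / 2) = (((1 + ‖ξ‖ ^ 2) ^ σ) ^ 2)⁻¹ := by
      rw [← Real.rpow_natCast ((1 + ‖ξ‖ ^ 2) ^ σ) 2, ← Real.rpow_mul (by positivity),
        ← Real.rpow_neg (by positivity)]
      congr 1
      push_cast
      ring
    rw [h2, inv_pow]
    have h3 : sobolevWeight σ ξ ^ 4 = (sobolevWeight σ ξ ^ 2) ^ 2 := by ring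
    rw [h3]
    have h4 : 0 < (1 + ‖ξ‖ ^ 2) ^ σ := by positivity
    gcongr
  refine ⟨by fun_prop, ?_⟩
  have h5 : eLpNorm (besselSymbol σ) 4 (volume : Measure ℝ) ^ 4 < ∞ := by
    rw [eLpNorm_four_pow]
    have := hi.2
    rw [hasFiniteIntegral_iff_enorm] at this
    simpa [enorm_pow] using this
  by_contra hcon
  rw [not_lt, top_le_iff] at hcon
  simp [hcon] at h5

/-- The isomorphism `L² → H^σ`, `g ↦ 𝓕⁻ ((1 + |2πξ|^{2σ})^{-1/2} g)`. -/
noncomputable def besselOp (σ : ℝ) : L2R →L[ℂ] L2R :=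
  (FourierTransform.fourierInvCLM ℂ L2R).comp (mulOp (besselSymbol σ) (memLp_top_besselSymbol σ))

theorem besselOp_apply (σ : ℝ) (g : L2R) :
    besselOp σ g = 𝓕⁻ (mulOp (besselSymbol σ) (memLp_top_besselSymbol σ) g) := rfl

theorem eLpNorm_besselOp_le {σ : ℝ} (hσ : 1 / 4 < σ) (hσ' : σ ≤ 1) (g : L2R) :
    eLpNorm (besselOp σ g) 4 volume ≤ eLpNorm (besselSymbol σ) 4 volume * ‖g‖ₑ := by
  rw [Lp.enorm_def]
  exact eLpNorm_fourierInv_mulOp_le _ (memLp_four_besselSymbol hσ hσ') g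

theorem memLp_four_besselOp {σ : ℝ} (hσ : 1 / 4 < σ) (hσ' : σ ≤ 1) (g : L2R) :
    MemLp (besselOp σ g) 4 volume :=
  ⟨Lp.aestronglyMeasurable _, (eLpNorm_besselOp_le hσ hσ' g).trans_lt
    (ENNReal.mul_lt_top (memLp_four_besselSymbol hσ hσ').2 (by simp))⟩

theorem norm_fourierInv_eq (f : L2R) : ‖(𝓕⁻ f : L2R)‖ = ‖f‖ := by
  rw [← Lp.norm_fourier_eq, FourierTransform.fourier_fourierInv_eq]

theorem norm_mulOp_le {k : ℝ → ℂ} (hk : MemLp k ∞ (volume : Measure ℝ)) (hk1 : ∀ x, ‖k x‖ ≤ 1)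
    (g : L2R) : ‖mulOp k hk g‖ ≤ ‖g‖ := by
  refine Lp.norm_le_norm_of_ae_le ?_
  filter_upwards [mulOp_ae hk g] with x hx
  rw [hx, norm_mul]
  exact mul_le_of_le_one_left (norm_nonneg _) (hk1 x)

theorem memLp_top_indicator_besselSymbol (σ : ℝ) {s : Set ℝ} (hs : MeasurableSet s) :
    MemLp (s.indicator (besselSymbol σ)) ∞ (volume : Measure ℝ) :=
  (memLp_top_besselSymbol σ).indicator hs

/-- The restriction of `besselOp` to the frequencies in a set `s`. -/
noncomputable def besselPiece (σ : ℝ) (s : Set ℝ) (hs : MeasurableSet s) (g : L2R) : L2R :=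
  𝓕⁻ (mulOp (s.indicator (besselSymbol σ)) (memLp_top_indicator_besselSymbol σ hs) g)

theorem besselPiece_add_compl (σ : ℝ) {s : Set ℝ} (hs : MeasurableSet s) (g : L2R) :
    besselOp σ g = besselPiece σ s hs g + besselPiece σ sᶜ hs.compl g := by
  rw [besselPiece, besselPiece, ← FourierTransform.fourierInv_add, besselOp_apply]
  congr 1
  apply Lp.ext
  filter_upwards [mulOp_ae (memLp_top_besselSymbol σ) g,
    mulOp_ae (memLp_top_indicator_besselSymbol σ hs) g,
    mulOp_ae (memLp_top_indicator_besselSymbol σ hs.compl) g,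
    Lp.coeFn_add (mulOp _ (memLp_top_indicator_besselSymbol σ hs) g)
      (mulOp _ (memLp_top_indicator_besselSymbol σ hs.compl) g)] with x h1 h2 h3 h4
  rw [h1, h4, Pi.add_apply, h2, h3, ← add_mul]
  congr 1
  exact (congrFun (Set.indicator_self_add_compl s (besselSymbol σ)) x).symm

theorem norm_besselPiece_le (σ : ℝ) {s : Set ℝ} (hs : MeasurableSet s) (g : L2R) :
    ‖besselPiece σ s hs g‖ ≤ ‖g‖ := by
  rw [besselPiece, norm_fourierInv_eq]
  refine norm_mulOp_le _ (fun x ↦ ?_) g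
  exact (norm_indicator_le_norm_self _ _).trans (norm_besselSymbol_le_one σ x)

theorem eLpNorm_besselPiece_le {σ : ℝ} (hσ : 1 / 4 < σ) (hσ' : σ ≤ 1) {s : Set ℝ}
    (hs : MeasurableSet s) (g : L2R) :
    eLpNorm (besselPiece σ s hs g) 4 volume
      ≤ eLpNorm (s.indicator (besselSymbol σ)) 4 volume * ‖g‖ₑ := by
  rw [Lp.enorm_def]
  exact eLpNorm_fourierInv_mulOp_le _ ((memLp_four_besselSymbol hσ hσ').indicator hs) g

theorem memLp_four_besselPiece {σ : ℝ} (hσ : 1 / 4 < σ) (hσ' : σ ≤ 1) {s : Set ℝ}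
    (hs : MeasurableSet s) (g : L2R) : MemLp (besselPiece σ s hs g) 4 volume :=
  ⟨Lp.aestronglyMeasurable _, (eLpNorm_besselPiece_le hσ hσ' hs g).trans_lt
    (ENNReal.mul_lt_top ((memLp_four_besselSymbol hσ hσ').indicator hs).2 (by simp))⟩

theorem exists_eLpNorm_indicator_compl_lt {σ : ℝ} (hσ : 1 / 4 < σ) (hσ' : σ ≤ 1) {ε : ℝ≥0∞}
    (hε : 0 < ε) : ∃ N : ℕ,
      eLpNorm ((Set.Ioc (-(N : ℝ)) N)ᶜ.indicator (besselSymbol σ)) 4 volume < ε := by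
  have h4 := memLp_four_besselSymbol hσ hσ'
  have hfin : ∫⁻ ξ, ‖besselSymbol σ ξ‖ₑ ^ 4 ≠ ∞ := by
    rw [← eLpNorm_four_pow]
    exact (ENNReal.pow_lt_top h4.2).ne
  have hlim : Tendsto (fun N : ℕ ↦
      ∫⁻ ξ, ‖(Set.Ioc (-(N : ℝ)) N)ᶜ.indicator (besselSymbol σ) ξ‖ₑ ^ 4) atTop
      (𝓝 (∫⁻ _ : ℝ, 0)) := by
    refine tendsto_lintegral_of_dominated_convergence (fun ξ ↦ ‖besselSymbol σ ξ‖ₑ ^ 4)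
      (fun N ↦ ?_) (fun N ↦ Eventually.of_forall fun ξ ↦ ?_) hfin
      (Eventually.of_forall fun ξ ↦ ?_)
    · have : Measurable ((Set.Ioc (-(N : ℝ)) N)ᶜ.indicator (besselSymbol σ)) :=
        (measurable_besselSymbol σ).indicator measurableSet_Ioc.compl
      fun_prop
    · refine pow_le_pow_left₀ zero_le ?_ 4
      exact enorm_indicator_le_enorm_self _ _
    · refine tendsto_const_nhds.congr' ?_
      filter_upwards [tendsto_natCast_atTop_atTop.eventually_gt_atTop |ξ|] with N hN
      have hmem : ξ ∈ Set.Ioc (-(N : ℝ)) N := ⟨(abs_lt.1 hN).1, (abs_lt.1 hN).2.le⟩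
      rw [Set.indicator_of_notMem (by simpa using hmem)]
      simp
  rw [lintegral_zero] at hlim
  obtain ⟨N, hN⟩ := (hlim.eventually (gt_mem_nhds (ENNReal.pow_pos hε 4 : 0 < ε ^ 4))).exists
  refine ⟨N, ?_⟩
  rw [← eLpNorm_four_pow] at hN
  exact (ENNReal.pow_lt_pow_left_iff four_ne_zero).1 hN

theorem memLp_lowKernel (σ a x : ℝ) : MemLp ((Set.Ioc (-a) a).indicator fun ξ ↦
    conj (Complex.exp ((2 * Real.pi * ξ * x : ℝ) * Complex.I)) * besselSymbol σ ξ) 2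
    (volume : Measure ℝ) := by
  rw [memLp_indicator_iff_restrict measurableSet_Ioc]
  refine MemLp.of_bound ?_ 1 (Eventually.of_forall fun ξ ↦ ?_)
  · refine Measurable.aestronglyMeasurable ?_
    exact (Complex.continuous_conj.measurable.comp (by fun_prop)).mul (measurable_besselSymbol σ)
  · rw [norm_mul, RCLike.norm_conj, Complex.norm_exp_ofReal_mul_I, one_mul]
    exact norm_besselSymbol_le_one σ ξ

/-- The `L²` function representing the evaluation at `x` of the low-frequency part of
`besselOp σ g`. -/
noncomputable def lowKernel (σ a x : ℝ) : L2R := (memLp_lowKernel σ a x).toLp _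

/-- Kernels at different points differ by a unimodular factor; hence the pointwise bound on
low-frequency parts is uniform in `x`. -/
theorem norm_lowKernel_eq (σ a x : ℝ) : ‖lowKernel σ a x‖ = ‖lowKernel σ a 0‖ := by
  have h : ‖lowKernel σ a x‖ ^ 2 = ‖lowKernel σ a 0‖ ^ 2 := by
    rw [lowKernel, lowKernel, L2R.norm_toLp_sq, L2R.norm_toLp_sq]
    congr 1
    ext ξ
    by_cases h : ξ ∈ Set.Ioc (-a) a
    · simp only [Set.indicator_of_mem h, norm_mul, RCLike.norm_conj,
        Complex.norm_exp_ofReal_mul_I]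
    · simp [Set.indicator_of_notMem h]
  exact (pow_left_inj₀ (norm_nonneg _) (norm_nonneg _) two_ne_zero).1 h

/-- A reproducing formula: evaluating a band-limited function is a bounded functional. It converts
weak convergence in `L²` into pointwise convergence of low-frequency parts. -/
theorem besselPiece_Ioc_ae_eq (σ : ℝ) {a : ℝ} (ha : 0 ≤ a) (g : L2R) :
    ∀ᵐ x, besselPiece σ (Set.Ioc (-a) a) measurableSet_Ioc g x = inner ℂ (lowKernel σ a x) g := by
  set f := mulOp (besselSymbol σ) (memLp_top_besselSymbol σ) g with hf
  have h1 : mulOp ((Set.Ioc (-a) a).indicator (besselSymbol σ))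
      (memLp_top_indicator_besselSymbol σ measurableSet_Ioc) g
      = (memLp_indicator_L2R f (measurableSet_Ioc (a := -a) (b := a))).toLp _ := by
    apply Lp.ext
    filter_upwards [mulOp_ae (memLp_top_besselSymbol σ) g,
      mulOp_ae (memLp_top_indicator_besselSymbol σ (measurableSet_Ioc (a := -a) (b := a))) g,
      (memLp_indicator_L2R f (measurableSet_Ioc (a := -a) (b := a))).coeFn_toLp] with x h1 h2 h3
    rw [h2, h3]
    by_cases h : x ∈ Set.Ioc (-a) a
    · simp only [Set.indicator_of_mem h, hf, h1]
    · simp [Set.indicator_of_notMem h]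
  rw [besselPiece, h1]
  filter_upwards [fourierInv_toLp_indicator_ae_eq ha f] with x hx
  rw [hx, truncFourierInv, L2.inner_def, intervalIntegral.integral_of_le (by linarith),
    ← integral_indicator measurableSet_Ioc]
  refine integral_congr_ae ?_
  filter_upwards [(memLp_lowKernel σ a x).coeFn_toLp, mulOp_ae (memLp_top_besselSymbol σ) g]
    with ξ h2 h3
  rw [lowKernel, h2]
  by_cases h : ξ ∈ Set.Ioc (-a) a
  · simp only [Set.indicator_of_mem h, hf, h3, RCLike.inner_apply, map_mul, Complex.conj_conj,
      besselSymbol, Complex.conj_ofReal]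
    ring
  · simp [Set.indicator_of_notMem h]

end BesselType

/-! ### Quartic integrals: Hölder bounds, expansion and splitting. -/

section LFour

theorem integrable_norm_pow_four {u : ℝ → ℂ} (hu : MemLp u 4 (volume : Measure ℝ)) :
    Integrable fun x ↦ ‖u x‖ ^ 4 := by
  have := hu.integrable_norm_pow (p := 4) (by norm_num)
  simpa using this

theorem integral_norm_pow_four {u : ℝ → ℂ} (hu : MemLp u 4 (volume : Measure ℝ)) :
    ∫ x, ‖u x‖ ^ 4 = (eLpNorm u 4 volume).toReal ^ 4 := by
  rw [← ENNReal.toReal_pow, eLpNorm_four_pow, integral_eq_lintegral_of_nonneg_ae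
    (Eventually.of_forall fun x ↦ by positivity) (integrable_norm_pow_four hu).1]
  congr 1
  refine lintegral_congr fun x ↦ ?_
  rw [ENNReal.ofReal_pow (norm_nonneg _), ofReal_norm]

theorem integral_mul_sq_le {f g : ℝ → ℝ} (hf : MemLp f 2 (volume : Measure ℝ))
    (hg : MemLp g 2 (volume : Measure ℝ)) :
    (∫ x, f x * g x) ^ 2 ≤ (∫ x, f x ^ 2) * ∫ x, g x ^ 2 := by
  have h := real_inner_mul_inner_self_le (hf.toLp f) (hg.toLp g)
  have e : ∀ {a b : ℝ → ℝ} (ha : MemLp a 2 (volume : Measure ℝ)) (hb : MemLp b 2 volume),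
      inner ℝ (ha.toLp a) (hb.toLp b) = ∫ x, a x * b x := by
    intro a b ha hb
    rw [L2.inner_def]
    refine integral_congr_ae ?_
    filter_upwards [ha.coeFn_toLp, hb.coeFn_toLp] with x h1 h2
    rw [h1, h2, RCLike.inner_apply]
    simp [mul_comm]
  rw [e hf hg, e hf hf, e hg hg] at h
  simpa only [sq] using h

theorem memLp_two_norm_mul_norm {u v : ℝ → ℂ} (hu : MemLp u 4 (volume : Measure ℝ))
    (hv : MemLp v 4 (volume : Measure ℝ)) :
    MemLp (fun x ↦ ‖u x‖ * ‖v x‖) 2 (volume : Measure ℝ) := by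
  have hm : AEStronglyMeasurable (fun x ↦ ‖u x‖ * ‖v x‖) volume := hu.1.norm.mul hv.1.norm
  rw [memLp_two_iff_integrable_sq hm]
  refine ((integrable_norm_pow_four hu).add (integrable_norm_pow_four hv)).mono'
    (hm.pow 2) (Eventually.of_forall fun x ↦ ?_)
  rw [Real.norm_of_nonneg (by positivity), Pi.add_apply]
  nlinarith [sq_nonneg (‖u x‖ ^ 2 - ‖v x‖ ^ 2), sq_nonneg (‖u x‖ ^ 2), sq_nonneg (‖v x‖ ^ 2)]

theorem integral_norm_sq_mul_norm_sq_sq_le {u v : ℝ → ℂ} (hu : MemLp u 4 (volume : Measure ℝ))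
    (hv : MemLp v 4 (volume : Measure ℝ)) :
    (∫ x, ‖u x‖ ^ 2 * ‖v x‖ ^ 2) ^ 2 ≤ (∫ x, ‖u x‖ ^ 4) * ∫ x, ‖v x‖ ^ 4 := by
  have h := integral_mul_sq_le (memLp_two_norm_mul_norm hu hu) (memLp_two_norm_mul_norm hv hv)
  have e : ∀ a : ℝ, a ^ 4 = (a * a) ^ 2 := fun a ↦ by ring
  simp_rw [e, sq (‖_‖)]
  exact h

theorem integrable_norm_sq_mul_norm_sq {u v : ℝ → ℂ} (hu : MemLp u 4 (volume : Measure ℝ))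
    (hv : MemLp v 4 (volume : Measure ℝ)) : Integrable fun x ↦ ‖u x‖ ^ 2 * ‖v x‖ ^ 2 := by
  have := (memLp_two_norm_mul_norm hu hv).integrable_sq
  simpa only [mul_pow] using this

theorem abs_re_conj_mul_le (z w : ℂ) : |(conj z * w).re| ≤ ‖z‖ * ‖w‖ := by
  refine (Complex.abs_re_le_norm _).trans (le_of_eq ?_)
  rw [norm_mul, RCLike.norm_conj]

theorem aestronglyMeasurable_re_conj_mul {u v : ℝ → ℂ} (hu : AEStronglyMeasurable u volume)
    (hv : AEStronglyMeasurable v volume) :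
    AEStronglyMeasurable (fun x ↦ (conj (u x) * v x).re) volume :=
  Complex.continuous_re.comp_aestronglyMeasurable
    ((Complex.continuous_conj.comp_aestronglyMeasurable hu).mul hv)

theorem memLp_two_re_conj_mul {u v : ℝ → ℂ} (hu : MemLp u 4 (volume : Measure ℝ))
    (hv : MemLp v 4 (volume : Measure ℝ)) :
    MemLp (fun x ↦ (conj (u x) * v x).re) 2 (volume : Measure ℝ) := by
  refine (memLp_two_norm_mul_norm hu hv).of_le (aestronglyMeasurable_re_conj_mul hu.1 hv.1)
    (Eventually.of_forall fun x ↦ ?_)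
  rw [Real.norm_eq_abs, Real.norm_of_nonneg (by positivity)]
  exact abs_re_conj_mul_le _ _

theorem memLp_two_norm_sq {u : ℝ → ℂ} (hu : MemLp u 4 (volume : Measure ℝ)) :
    MemLp (fun x ↦ ‖u x‖ ^ 2) 2 (volume : Measure ℝ) := by
  simpa only [sq] using memLp_two_norm_mul_norm hu hu

theorem norm_add_ofReal_mul_pow_four (z w : ℂ) (t : ℝ) :
    ‖z + t * w‖ ^ 4 = ‖z‖ ^ 4 + 4 * t * (‖z‖ ^ 2 * (conj z * w).re)
      + t ^ 2 * (4 * (conj z * w).re ^ 2 + 2 * (‖z‖ ^ 2 * ‖w‖ ^ 2))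
      + 4 * t ^ 3 * (‖w‖ ^ 2 * (conj z * w).re) + t ^ 4 * ‖w‖ ^ 4 := by
  have e : ∀ a : ℂ, ‖a‖ ^ 4 = (‖a‖ ^ 2) ^ 2 := fun a ↦ by ring
  simp only [e, Complex.sq_norm, Complex.normSq_apply, Complex.add_re, Complex.add_im,
    Complex.mul_re, Complex.mul_im, Complex.ofReal_re, Complex.ofReal_im, Complex.conj_re,
    Complex.conj_im]
  ring

theorem integral_norm_add_ofReal_mul_pow_four {u v : ℝ → ℂ}
    (hu : MemLp u 4 (volume : Measure ℝ)) (hv : MemLp v 4 (volume : Measure ℝ)) (t : ℝ) :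
    ∫ x, ‖u x + t * v x‖ ^ 4 = (∫ x, ‖u x‖ ^ 4) + 4 * t * (∫ x, ‖u x‖ ^ 2 * (conj (u x) * v x).re)
      + t ^ 2 * (∫ x, (4 * (conj (u x) * v x).re ^ 2 + 2 * (‖u x‖ ^ 2 * ‖v x‖ ^ 2)))
      + 4 * t ^ 3 * (∫ x, ‖v x‖ ^ 2 * (conj (u x) * v x).re) + t ^ 4 * ∫ x, ‖v x‖ ^ 4 := by
  have hp := memLp_two_re_conj_mul hu hv
  have i0 := integrable_norm_pow_four hu
  have i1 : Integrable fun x ↦ ‖u x‖ ^ 2 * (conj (u x) * v x).re :=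
    (memLp_two_norm_sq hu).integrable_mul hp
  have i2 : Integrable fun x ↦ 4 * (conj (u x) * v x).re ^ 2 + 2 * (‖u x‖ ^ 2 * ‖v x‖ ^ 2) :=
    (hp.integrable_sq.const_mul 4).add ((integrable_norm_sq_mul_norm_sq hu hv).const_mul 2)
  have i3 : Integrable fun x ↦ ‖v x‖ ^ 2 * (conj (u x) * v x).re :=
    (memLp_two_norm_sq hv).integrable_mul hp
  have i4 := integrable_norm_pow_four hv
  have j1 : Integrable fun x ↦ ‖u x‖ ^ 4 + 4 * t * (‖u x‖ ^ 2 * (conj (u x) * v x).re) :=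
    i0.add (i1.const_mul _)
  have j2 : Integrable fun x ↦ ‖u x‖ ^ 4 + 4 * t * (‖u x‖ ^ 2 * (conj (u x) * v x).re)
      + t ^ 2 * (4 * (conj (u x) * v x).re ^ 2 + 2 * (‖u x‖ ^ 2 * ‖v x‖ ^ 2)) :=
    j1.add (i2.const_mul _)
  have j3 : Integrable fun x ↦ ‖u x‖ ^ 4 + 4 * t * (‖u x‖ ^ 2 * (conj (u x) * v x).re)
      + t ^ 2 * (4 * (conj (u x) * v x).re ^ 2 + 2 * (‖u x‖ ^ 2 * ‖v x‖ ^ 2))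
      + 4 * t ^ 3 * (‖v x‖ ^ 2 * (conj (u x) * v x).re) := j2.add (i3.const_mul _)
  simp_rw [norm_add_ofReal_mul_pow_four]
  rw [integral_add j3 (i4.const_mul _), integral_add j2 (i3.const_mul _),
    integral_add j1 (i2.const_mul _), integral_add i0 (i1.const_mul _), integral_const_mul,
    integral_const_mul, integral_const_mul, integral_const_mul]

theorem abs_integral_norm_sq_mul_re_le {u v w : ℝ → ℂ} (hu : MemLp u 4 (volume : Measure ℝ))
    (hv : MemLp v 4 (volume : Measure ℝ)) (hw : MemLp w 4 (volume : Measure ℝ)) :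
    |∫ x, ‖w x‖ ^ 2 * (conj (u x) * v x).re|
      ≤ √((∫ x, ‖w x‖ ^ 4) * ∫ x, ‖u x‖ ^ 2 * ‖v x‖ ^ 2) := by
  refine Real.abs_le_sqrt ((integral_mul_sq_le (memLp_two_norm_sq hw)
    (memLp_two_re_conj_mul hu hv)).trans ?_)
  have e : ∫ x, (‖w x‖ ^ 2) ^ 2 = ∫ x, ‖w x‖ ^ 4 := by simp_rw [← pow_mul]
  rw [e]
  refine mul_le_mul_of_nonneg_left (integral_mono (memLp_two_re_conj_mul hu hv).integrable_sq
    (integrable_norm_sq_mul_norm_sq hu hv) fun x ↦ ?_) (integral_nonneg fun x ↦ by positivity)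
  have := abs_re_conj_mul_le (u x) (v x)
  have h2 := pow_le_pow_left₀ (abs_nonneg _) this 2
  rwa [sq_abs, mul_pow] at h2

/-- A quantitative Brezis–Lieb splitting in `L⁴`. -/
theorem abs_integral_norm_add_pow_four_sub_le {u v : ℝ → ℂ} (hu : MemLp u 4 (volume : Measure ℝ))
    (hv : MemLp v 4 (volume : Measure ℝ)) :
    |(∫ x, ‖u x + v x‖ ^ 4) - (∫ x, ‖u x‖ ^ 4) - ∫ x, ‖v x‖ ^ 4|
      ≤ 4 * √((∫ x, ‖u x‖ ^ 4) * ∫ x, ‖u x‖ ^ 2 * ‖v x‖ ^ 2)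
        + 6 * (∫ x, ‖u x‖ ^ 2 * ‖v x‖ ^ 2)
        + 4 * √((∫ x, ‖v x‖ ^ 4) * ∫ x, ‖u x‖ ^ 2 * ‖v x‖ ^ 2) := by
  have h := integral_norm_add_ofReal_mul_pow_four hu hv 1
  simp only [Complex.ofReal_one, one_mul, mul_one, one_pow] at h
  have hX := integrable_norm_sq_mul_norm_sq hu hv
  have i2 : Integrable fun x ↦ 4 * (conj (u x) * v x).re ^ 2 + 2 * (‖u x‖ ^ 2 * ‖v x‖ ^ 2) :=
    ((memLp_two_re_conj_mul hu hv).integrable_sq.const_mul 4).add (hX.const_mul 2)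
  have h2 : |∫ x, (4 * (conj (u x) * v x).re ^ 2 + 2 * (‖u x‖ ^ 2 * ‖v x‖ ^ 2))|
      ≤ 6 * ∫ x, ‖u x‖ ^ 2 * ‖v x‖ ^ 2 := by
    rw [abs_of_nonneg (integral_nonneg fun x ↦ by positivity), ← integral_const_mul]
    refine integral_mono i2 (hX.const_mul 6) fun x ↦ ?_
    have := pow_le_pow_left₀ (abs_nonneg _) (abs_re_conj_mul_le (u x) (v x)) 2
    rw [sq_abs, mul_pow] at this
    simp only
    linarith
  have h1 := abs_integral_norm_sq_mul_re_le hu hv hu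
  have h3 := abs_integral_norm_sq_mul_re_le hu hv hv
  rw [abs_le] at h1 h2 h3 ⊢
  constructor <;> linarith [h1.1, h1.2, h2.1, h2.2, h3.1, h3.2]

end LFour

/-! ### Local compactness and non-vanishing, by splitting low and high frequencies. -/

section Compactness

theorem eLpNorm_le_ofReal_of_le {σ : ℝ} (hσ : 1 / 4 < σ) (hσ' : σ ≤ 1) {s : Set ℝ}
    (hs : MeasurableSet s) {ε B : ℝ} (hε : 0 ≤ ε)
    (h : eLpNorm (s.indicator (besselSymbol σ)) 4 volume ≤ ENNReal.ofReal ε) {g : L2R}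
    (hg : ‖g‖ ≤ B) : (eLpNorm (besselPiece σ s hs g) 4 volume).toReal ≤ ε * B := by
  have h1 := (eLpNorm_besselPiece_le hσ hσ' hs g).trans (mul_le_mul_left h _)
  rw [← ofReal_norm, ← ENNReal.ofReal_mul hε] at h1
  exact (ENNReal.toReal_le_of_le_ofReal (by positivity) h1).trans
    (mul_le_mul_of_nonneg_left hg hε)

/-- Multiplication by `u ∈ L² ∩ L⁴` is a compact operator `H^σ → L²`. -/
theorem tendsto_integral_norm_sq_mul_besselOp {σ : ℝ} (hσ : 1 / 4 < σ) (hσ' : σ ≤ 1) (u : L2R)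
    (hu : MemLp u 4 volume) {r : ℕ → L2R} {B : ℝ} (hB : ∀ n, ‖r n‖ ≤ B)
    (hweak : ∀ y : L2R, Tendsto (fun n ↦ inner ℂ y (r n)) atTop (𝓝 0)) :
    Tendsto (fun n ↦ ∫ x, ‖u x‖ ^ 2 * ‖besselOp σ (r n) x‖ ^ 2) atTop (𝓝 0) := by
  have hB0 : 0 ≤ B := (norm_nonneg _).trans (hB 0)
  set A : ℝ := √(∫ x, ‖u x‖ ^ 4) with hA
  rw [Metric.tendsto_atTop]
  intro δ hδ
  -- This makes the high-frequency bound `A (ε B)²` less than `δ / 4`; the low part is also brought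
  -- below `δ / 4`, and each enters the final estimate with a factor 2.
  set ε : ℝ := √(δ / (4 * (A * B ^ 2 + 1))) with hε
  have hAB : 0 < A * B ^ 2 + 1 := by positivity
  have hε0 : 0 < ε := Real.sqrt_pos.2 (by positivity)
  have hε2 : ε ^ 2 = δ / (4 * (A * B ^ 2 + 1)) := Real.sq_sqrt (by positivity)
  obtain ⟨N, hN⟩ := exists_eLpNorm_indicator_compl_lt hσ hσ' (ENNReal.ofReal_pos.2 hε0)
  set s : Set ℝ := Set.Ioc (-(N : ℝ)) N with hs
  have hsm : MeasurableSet s := measurableSet_Ioc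
  have hhigh : ∀ n, ∫ x, ‖u x‖ ^ 2 * ‖besselPiece σ sᶜ hsm.compl (r n) x‖ ^ 2
      ≤ A * (ε * B) ^ 2 := by
    intro n
    have hm := memLp_four_besselPiece hσ hσ' hsm.compl (r n)
    have h1 := integral_norm_sq_mul_norm_sq_sq_le hu hm
    have h2 : ∫ x, ‖besselPiece σ sᶜ hsm.compl (r n) x‖ ^ 4 ≤ (ε * B) ^ 4 := by
      rw [integral_norm_pow_four hm]
      exact pow_le_pow_left₀ ENNReal.toReal_nonneg
        (eLpNorm_le_ofReal_of_le hσ hσ' hsm.compl hε0.le hN.le (hB n)) 4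
    have hA2 : A ^ 2 = ∫ x, ‖u x‖ ^ 4 := Real.sq_sqrt (integral_nonneg fun x ↦ by positivity)
    refine (pow_le_pow_iff_left₀ (integral_nonneg fun x ↦ by positivity) (by positivity)
      two_ne_zero).1 (h1.trans ?_)
    rw [mul_pow, hA2, ← pow_mul]
    exact mul_le_mul_of_nonneg_left h2 (integral_nonneg fun x ↦ by positivity)
  have hlow : Tendsto (fun n ↦ ∫ x, ‖u x‖ ^ 2 * ‖besselPiece σ s hsm (r n) x‖ ^ 2) atTop
      (𝓝 (∫ _ : ℝ, (0 : ℝ))) := by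
    have hrep := fun n ↦ besselPiece_Ioc_ae_eq σ (Nat.cast_nonneg N) (r n)
    refine tendsto_integral_of_dominated_convergence
      (fun x ↦ ‖u x‖ ^ 2 * (‖lowKernel σ N 0‖ * B) ^ 2) (fun n ↦ ?_) ?_ (fun n ↦ ?_) ?_
    · exact ((Lp.aestronglyMeasurable u).norm.pow 2).mul
        ((Lp.aestronglyMeasurable (besselPiece σ s hsm (r n))).norm.pow 2)
    · exact u.integrable_norm_sq.mul_const _
    · filter_upwards [hrep n] with x hx
      rw [Real.norm_of_nonneg (by positivity)]
      gcongr
      rw [hx]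
      refine (norm_inner_le_norm _ _).trans ?_
      rw [norm_lowKernel_eq]
      exact mul_le_mul_of_nonneg_left (hB n) (norm_nonneg _)
    -- For almost every `x` the low part is a pairing with the fixed vector `lowKernel σ N x`, so
    -- weak convergence sends it to 0.
    · filter_upwards [ae_all_iff.2 hrep] with x hx
      have h0 := ((hweak (lowKernel σ N x)).norm.pow 2).const_mul (‖u x‖ ^ 2)
      simp only [norm_zero, ne_eq, OfNat.ofNat_ne_zero, not_false_eq_true, zero_pow,
        mul_zero] at h0
      exact h0.congr fun n ↦ by rw [← hx n]
  rw [integral_zero] at hlow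
  obtain ⟨n₀, hn₀⟩ := (Metric.tendsto_atTop.1 hlow) (δ / 4) (by positivity)
  refine ⟨n₀, fun n hn ↦ ?_⟩
  have h1 := hn₀ n hn
  rw [Real.dist_eq, sub_zero, abs_of_nonneg (integral_nonneg fun x ↦ by positivity)] at h1 ⊢
  have iL := integrable_norm_sq_mul_norm_sq hu (memLp_four_besselPiece hσ hσ' hsm (r n))
  have iH := integrable_norm_sq_mul_norm_sq hu (memLp_four_besselPiece hσ hσ' hsm.compl (r n))
  have h2 : ∫ x, ‖u x‖ ^ 2 * ‖besselOp σ (r n) x‖ ^ 2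
      ≤ 2 * (∫ x, ‖u x‖ ^ 2 * ‖besselPiece σ s hsm (r n) x‖ ^ 2)
        + 2 * ∫ x, ‖u x‖ ^ 2 * ‖besselPiece σ sᶜ hsm.compl (r n) x‖ ^ 2 := by
    rw [← integral_const_mul, ← integral_const_mul,
      ← integral_add (iL.const_mul 2) (iH.const_mul 2)]
    refine integral_mono_ae (integrable_norm_sq_mul_norm_sq hu (memLp_four_besselOp hσ hσ' (r n)))
      ((iL.const_mul 2).add (iH.const_mul 2)) ?_
    have hsplit := besselPiece_add_compl σ hsm (r n)
    filter_upwards [Lp.coeFn_add (besselPiece σ s hsm (r n))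
      (besselPiece σ sᶜ hsm.compl (r n))] with x hx
    rw [hsplit, hx, Pi.add_apply]
    set a := besselPiece σ s hsm (r n) x
    set b := besselPiece σ sᶜ hsm.compl (r n) x
    have h3 : ‖a + b‖ ^ 2 ≤ 2 * ‖a‖ ^ 2 + 2 * ‖b‖ ^ 2 := by
      have := pow_le_pow_left₀ (norm_nonneg _) (norm_add_le a b) 2
      nlinarith [sq_nonneg (‖a‖ - ‖b‖)]
    nlinarith [sq_nonneg ‖u x‖]
  have h3 : A * (ε * B) ^ 2 < δ / 4 := by
    rw [mul_pow, hε2]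
    have : A * (δ / (4 * (A * B ^ 2 + 1)) * B ^ 2) = δ / 4 * ((A * B ^ 2) / (A * B ^ 2 + 1)) := by
      field_simp
    rw [this]
    refine mul_lt_of_lt_one_right (by positivity) ?_
    rw [div_lt_one hAB]
    linarith
  linarith [hhigh n]

/-- Non-vanishing: a bounded function in `H^σ` with `L⁴` norm bounded below has a large
low-frequency part somewhere. -/
theorem exists_le_norm_inner_lowKernel {σ : ℝ} (hσ : 1 / 4 < σ) (hσ' : σ ≤ 1) {c : ℝ}
    (hc : 0 < c) : ∃ (δ : ℝ) (N : ℕ), 0 < δ ∧ ∀ g : L2R, ‖g‖ ≤ 1 →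
      c ≤ (eLpNorm (besselOp σ g) 4 volume).toReal → ∃ x, δ ≤ ‖inner ℂ (lowKernel σ N x) g‖ := by
  obtain ⟨N, hN⟩ := exists_eLpNorm_indicator_compl_lt hσ hσ' (ENNReal.ofReal_pos.2 (half_pos hc))
  -- If the low part stayed below this `δ` everywhere, its quartic integral would be at most `δ²
  -- ‖g‖² ≤ (c/2)⁴ / 4`. But the high part has `L⁴` norm at most `c/2`, leaving at least `c/2` for
  -- the low part.
  refine ⟨(c / 2) ^ 2 / 2, N, by positivity, fun g hg hcg ↦ ?_⟩
  by_contra! hcon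
  set s : Set ℝ := Set.Ioc (-(N : ℝ)) N with hs
  have hsm : MeasurableSet s := measurableSet_Ioc
  have hlow4 := memLp_four_besselPiece hσ hσ' hsm g
  have hhigh4 := memLp_four_besselPiece hσ hσ' hsm.compl g
  have h1 : (eLpNorm (besselPiece σ sᶜ hsm.compl g) 4 volume).toReal ≤ c / 2 := by
    simpa using eLpNorm_le_ofReal_of_le hσ hσ' hsm.compl (half_pos hc).le hN.le hg
  have h2 : (eLpNorm (besselOp σ g) 4 volume).toReal
      ≤ (eLpNorm (besselPiece σ s hsm g) 4 volume).toReal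
        + (eLpNorm (besselPiece σ sᶜ hsm.compl g) 4 volume).toReal := by
    rw [← ENNReal.toReal_add hlow4.2.ne hhigh4.2.ne, besselPiece_add_compl σ hsm g]
    refine ENNReal.toReal_mono (ENNReal.add_ne_top.2 ⟨hlow4.2.ne, hhigh4.2.ne⟩) ?_
    rw [eLpNorm_congr_ae (Lp.coeFn_add _ _)]
    exact eLpNorm_add_le hlow4.1 hhigh4.1 (by norm_num)
  have h3 : (c / 2) ^ 4 ≤ ∫ x, ‖besselPiece σ s hsm g x‖ ^ 4 := by
    rw [integral_norm_pow_four hlow4]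
    exact pow_le_pow_left₀ (by positivity) (by linarith) 4
  have h4 : ∫ x, ‖besselPiece σ s hsm g x‖ ^ 4
      ≤ ∫ x, ((c / 2) ^ 2 / 2) ^ 2 * ‖besselPiece σ s hsm g x‖ ^ 2 := by
    refine integral_mono_ae (integrable_norm_pow_four hlow4)
      ((L2R.integrable_norm_sq _).const_mul _) ?_
    filter_upwards [besselPiece_Ioc_ae_eq σ (Nat.cast_nonneg N) g] with x hx
    have h5 : ‖besselPiece σ s hsm g x‖ ≤ (c / 2) ^ 2 / 2 := by
      rw [hx]
      exact (hcon x).le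
    have : ‖besselPiece σ s hsm g x‖ ^ 4
        = ‖besselPiece σ s hsm g x‖ ^ 2 * ‖besselPiece σ s hsm g x‖ ^ 2 := by ring
    rw [this]
    gcongr
  rw [integral_const_mul, ← L2R.norm_sq_eq_integral] at h4
  have h6 : ‖besselPiece σ s hsm g‖ ^ 2 ≤ 1 :=
    pow_le_one₀ (norm_nonneg _) ((norm_besselPiece_le σ hsm g).trans hg)
  have h7 : ((c / 2) ^ 2 / 2) ^ 2 * ‖besselPiece σ s hsm g‖ ^ 2 ≤ ((c / 2) ^ 2 / 2) ^ 2 :=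
    mul_le_of_le_one_right (by positivity) h6
  have h8 : 0 < (c / 2) ^ 4 := by positivity
  nlinarith

end Compactness

/-! ### Weak sequential compactness in a separable Hilbert space. -/

section WeakCompactness

theorem exists_subseq_weak_tendsto {H : Type*} [NormedAddCommGroup H] [InnerProductSpace ℂ H]
    [CompleteSpace H] [TopologicalSpace.SeparableSpace H] {x : ℕ → H} {B : ℝ}
    (hB : ∀ n, ‖x n‖ ≤ B) : ∃ φ : ℕ → ℕ, StrictMono φ ∧ ∃ g : H,
      ∀ y, Tendsto (fun n ↦ inner ℂ y (x (φ n))) atTop (𝓝 (inner ℂ y g)) := by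
  have hB0 : 0 ≤ B := (norm_nonneg _).trans (hB 0)
  set d := TopologicalSpace.denseSeq H
  have hK : IsCompact (Set.pi Set.univ fun k : ℕ ↦ Metric.closedBall (0 : ℂ) (B * ‖d k‖)) :=
    isCompact_univ_pi fun k ↦ isCompact_closedBall _ _
  -- Compactness of a countable product of discs replaces the diagonal extraction: one subsequence
  -- works for every vector of the dense sequence.
  obtain ⟨ℓ, -, φ, hφ, hlim⟩ := hK.tendsto_subseq (x := fun n k ↦ inner ℂ (x n) (d k))
    (fun n k _ ↦ by
      rw [mem_closedBall_zero_iff]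
      exact (norm_inner_le_norm _ _).trans (mul_le_mul_of_nonneg_right (hB n) (norm_nonneg _)))
  rw [tendsto_pi_nhds] at hlim
  have hcauchy : ∀ y, ∃ l, Tendsto (fun n ↦ inner ℂ (x (φ n)) y) atTop (𝓝 l) := by
    intro y
    refine cauchySeq_tendsto_of_complete (Metric.cauchySeq_iff'.2 fun ε hε ↦ ?_)
    have hε' : 0 < ε / (3 * (B + 1)) := by positivity
    obtain ⟨k, hk⟩ := (TopologicalSpace.denseRange_denseSeq H).exists_dist_lt y hε'
    obtain ⟨N, hN⟩ := Metric.cauchySeq_iff'.1 (hlim k).cauchySeq (ε / 3) (by positivity)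
    refine ⟨N, fun n hn ↦ ?_⟩
    have h1 : ∀ m, dist (inner ℂ (x m) y) (inner ℂ (x m) (d k)) < ε / 3 := by
      intro m
      rw [dist_eq_norm, ← inner_sub_right]
      refine (norm_inner_le_norm _ _).trans_lt ?_
      rw [dist_eq_norm] at hk
      calc ‖x m‖ * ‖y - d k‖ ≤ B * (ε / (3 * (B + 1))) :=
            mul_le_mul (hB m) hk.le (norm_nonneg _) hB0
        _ < (B + 1) * (ε / (3 * (B + 1))) := by
            apply mul_lt_mul_of_pos_right _ hε'
            linarith
        _ = ε / 3 := by field_simp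
    have h2 := hN n hn
    simp only [Function.comp_apply] at h2
    have h3 := h1 (φ n)
    have h4 := h1 (φ N)
    rw [dist_comm] at h4
    have := dist_triangle4 (inner ℂ (x (φ n)) y) (inner ℂ (x (φ n)) (d k))
      (inner ℂ (x (φ N)) (d k)) (inner ℂ (x (φ N)) y)
    change dist (inner ℂ (x (φ n)) y) (inner ℂ (x (φ N)) y) < ε
    linarith
  choose f hf using hcauchy
  set L : H →L[ℂ] ℂ := continuousLinearMapOfTendsto (fun n ↦ innerSL ℂ (x (φ n)))
    (tendsto_pi_nhds.2 hf) with hL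
  have hLf : ∀ y, L y = f y := fun y ↦ rfl
  refine ⟨φ, hφ, (InnerProductSpace.toDual ℂ H).symm L, fun y ↦ ?_⟩
  have h := (Complex.continuous_conj.tendsto _).comp (hf y)
  rw [← hLf y, ← InnerProductSpace.toDual_symm_apply (y := L), inner_conj_symm] at h
  exact h.congr fun n ↦ by rw [Function.comp_apply, inner_conj_symm]

end WeakCompactness

/-! ### Translation, conjugation and dilation on the frequency side. -/

section Symmetries

theorem memLp_top_character (y : ℝ) :
    MemLp (fun ξ : ℝ ↦ Complex.exp ((2 * Real.pi * ξ * y : ℝ) * Complex.I)) ∞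
      (volume : Measure ℝ) :=
  memLp_top_of_bound (by fun_prop) 1
    (Eventually.of_forall fun _ ↦ (Complex.norm_exp_ofReal_mul_I _).le)

/-- Multiplication by the character `e^{2πiyξ}`. -/
noncomputable def modulation (y : ℝ) : L2R →L[ℂ] L2R := mulOp _ (memLp_top_character y)

theorem modulation_ae (y : ℝ) (g : L2R) :
    ∀ᵐ ξ, modulation y g ξ = Complex.exp ((2 * Real.pi * ξ * y : ℝ) * Complex.I) * g ξ :=
  mulOp_ae _ g

theorem norm_modulation_le (y : ℝ) (g : L2R) : ‖modulation y g‖ ≤ ‖g‖ :=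
  norm_mulOp_le _ (fun _ ↦ (Complex.norm_exp_ofReal_mul_I _).le) g

theorem inner_lowKernel_eq_modulation (σ a y : ℝ) (g : L2R) :
    inner ℂ (lowKernel σ a y) g = inner ℂ (lowKernel σ a 0) (modulation y g) := by
  rw [L2.inner_def, L2.inner_def]
  refine integral_congr_ae ?_
  filter_upwards [(memLp_lowKernel σ a y).coeFn_toLp, (memLp_lowKernel σ a 0).coeFn_toLp,
    modulation_ae y g] with ξ h1 h2 h3
  rw [lowKernel, lowKernel, h1, h2, h3]
  by_cases h : ξ ∈ Set.Ioc (-a) a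
  · simp only [Set.indicator_of_mem h, RCLike.inner_apply, map_mul, Complex.conj_conj, mul_zero,
      Complex.ofReal_zero, zero_mul, Complex.exp_zero]
    ring
  · simp [Set.indicator_of_notMem h]

theorem besselOp_modulation_ae (σ y : ℝ) (g : L2R) :
    ∀ᵐ x, besselOp σ (modulation y g) x = besselOp σ g (x + y) := by
  refine fourierInv_modulation (mulOp _ (memLp_top_besselSymbol σ) g)
    (mulOp _ (memLp_top_besselSymbol σ) (modulation y g)) y ?_
  filter_upwards [mulOp_ae (memLp_top_besselSymbol σ) g, modulation_ae y g,
    mulOp_ae (memLp_top_besselSymbol σ) (modulation y g)] with ξ h1 h2 h3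
  rw [h3, h2, h1]
  ring

/-- The quartic functional `g ↦ ‖u‖_{L⁴}⁴` where `u = besselOp σ g`. -/
noncomputable def quartic (σ : ℝ) (g : L2R) : ℝ := ∫ x, ‖besselOp σ g x‖ ^ 4

theorem quartic_nonneg (σ : ℝ) (g : L2R) : 0 ≤ quartic σ g :=
  integral_nonneg fun x ↦ by positivity

theorem quartic_modulation (σ y : ℝ) (g : L2R) : quartic σ (modulation y g) = quartic σ g := by
  rw [quartic, quartic, ← integral_add_right_eq_self (fun x ↦ ‖besselOp σ g x‖ ^ 4) y]
  refine integral_congr_ae ?_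
  filter_upwards [besselOp_modulation_ae σ y g] with x hx
  rw [hx]

theorem quartic_smul (σ : ℝ) (c : ℂ) (g : L2R) : quartic σ (c • g) = ‖c‖ ^ 4 * quartic σ g := by
  rw [quartic, quartic, ← integral_const_mul, map_smul]
  refine integral_congr_ae ?_
  filter_upwards [Lp.coeFn_smul c (besselOp σ g)] with x hx
  rw [hx, Pi.smul_apply, norm_smul, mul_pow]

theorem exists_besselOp_eq_conj (σ : ℝ) (g : L2R) :
    ∃ h : L2R, ‖h‖ = ‖g‖ ∧ ∀ᵐ x, besselOp σ h x = conj (besselOp σ g x) := by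
  have hneg : MeasurePreserving (fun ξ : ℝ ↦ -ξ) volume volume := Measure.measurePreserving_neg _
  have hm : MemLp (fun ξ ↦ conj (g (-ξ))) 2 (volume : Measure ℝ) :=
    ((Lp.memLp g).comp_measurePreserving hneg).star
  refine ⟨hm.toLp _, ?_, ?_⟩
  · have : ‖hm.toLp _‖ ^ 2 = ‖g‖ ^ 2 := by
      rw [L2R.norm_toLp_sq, L2R.norm_sq_eq_integral]
      simp only [RCLike.norm_conj]
      exact integral_neg_eq_self (fun x ↦ ‖g x‖ ^ 2) volume
    exact (pow_left_inj₀ (norm_nonneg _) (norm_nonneg _) two_ne_zero).1 this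
  · refine fourierInv_conj_neg (mulOp _ (memLp_top_besselSymbol σ) g)
      (mulOp _ (memLp_top_besselSymbol σ) (hm.toLp _)) ?_
    filter_upwards [mulOp_ae (memLp_top_besselSymbol σ) (hm.toLp _), hm.coeFn_toLp,
      hneg.quasiMeasurePreserving.ae (mulOp_ae (memLp_top_besselSymbol σ) g)] with ξ h1 h2 h3
    rw [h1, h2, h3, map_mul, besselSymbol, besselSymbol, sobolevWeight_neg, Complex.conj_ofReal]

theorem norm_sq_eq_sobolevWeight_sq_mul (σ : ℝ) (g : L2R) :
    ∀ᵐ ξ, ‖g ξ‖ ^ 2 = ‖mulOp (besselSymbol σ) (memLp_top_besselSymbol σ) g ξ‖ ^ 2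
      + |2 * Real.pi * ξ| ^ (2 * σ)
        * ‖mulOp (besselSymbol σ) (memLp_top_besselSymbol σ) g ξ‖ ^ 2 := by
  filter_upwards [mulOp_ae (memLp_top_besselSymbol σ) g] with ξ hξ
  have h := sobolevWeight_sq σ ξ
  have h0 := sobolevWeight_pos σ ξ
  rw [hξ, norm_mul, norm_besselSymbol, ← one_add_mul, ← h]
  field_simp

theorem integrable_rpow_mul_norm_sq (σ : ℝ) (g : L2R) : Integrable fun ξ ↦
    |2 * Real.pi * ξ| ^ (2 * σ) * ‖mulOp (besselSymbol σ) (memLp_top_besselSymbol σ) g ξ‖ ^ 2 := by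
  refine (g.integrable_norm_sq.sub (mulOp (besselSymbol σ)
    (memLp_top_besselSymbol σ) g).integrable_norm_sq).congr ?_
  filter_upwards [norm_sq_eq_sobolevWeight_sq_mul σ g] with ξ hξ
  rw [Pi.sub_apply, hξ]
  ring

theorem norm_besselOp_eq (σ : ℝ) (g : L2R) :
    ‖besselOp σ g‖ = ‖mulOp (besselSymbol σ) (memLp_top_besselSymbol σ) g‖ :=
  norm_fourierInv_eq _

theorem norm_sq_eq_norm_besselOp_sq_add (σ : ℝ) (g : L2R) :
    ‖g‖ ^ 2 = ‖besselOp σ g‖ ^ 2 + ∫ ξ, |2 * Real.pi * ξ| ^ (2 * σ)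
      * ‖mulOp (besselSymbol σ) (memLp_top_besselSymbol σ) g ξ‖ ^ 2 := by
  rw [norm_besselOp_eq, L2R.norm_sq_eq_integral, L2R.norm_sq_eq_integral,
    ← integral_add (L2R.integrable_norm_sq _) (integrable_rpow_mul_norm_sq σ g)]
  exact integral_congr_ae (norm_sq_eq_sobolevWeight_sq_mul σ g)

/-- Dilation `u ↦ u(b ·)` on `H^σ`. -/
theorem exists_dilation (σ : ℝ) (g : L2R) {b : ℝ} (hb : 0 < b) :
    ∃ h : L2R, ‖h‖ ^ 2 = b⁻¹ * (‖besselOp σ g‖ ^ 2 + b ^ (2 * σ)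
        * ∫ ξ, |2 * Real.pi * ξ| ^ (2 * σ)
          * ‖mulOp (besselSymbol σ) (memLp_top_besselSymbol σ) g ξ‖ ^ 2) ∧
      quartic σ h = b⁻¹ * quartic σ g := by
  set f := mulOp (besselSymbol σ) (memLp_top_besselSymbol σ) g with hf
  have hb' : b⁻¹ ≠ 0 := inv_ne_zero hb.ne'
  set G : ℝ → ℝ := fun η ↦ (b⁻¹) ^ 2 * (‖f η‖ ^ 2 + b ^ (2 * σ)
    * (|2 * Real.pi * η| ^ (2 * σ) * ‖f η‖ ^ 2)) with hG
  have hGi : Integrable G :=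
    (f.integrable_norm_sq.add ((integrable_rpow_mul_norm_sq σ g).const_mul _)).const_mul _
  -- The transform of `u(b ·)` is `b⁻¹ û(ξ / b)`; multiplying by the weight gives its preimage under
  -- `besselOp σ`.
  set F : ℝ → ℂ := fun ξ ↦ (sobolevWeight σ ξ : ℂ) * ((b⁻¹ : ℝ) * f (b⁻¹ * ξ)) with hF
  have hqmp : Measure.QuasiMeasurePreserving (fun ξ : ℝ ↦ b⁻¹ * ξ) volume volume := by
    simpa using quasiMeasurePreserving_affine hb' 0
  have hFm : AEStronglyMeasurable F volume := by
    refine AEStronglyMeasurable.mul (by fun_prop) (AEStronglyMeasurable.mul (by fun_prop) ?_)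
    exact (Lp.aestronglyMeasurable f).comp_quasiMeasurePreserving hqmp
  have hFG : ∀ ξ, ‖F ξ‖ ^ 2 = G (b⁻¹ * ξ) := by
    intro ξ
    have h1 : |2 * Real.pi * ξ| ^ (2 * σ)
        = b ^ (2 * σ) * |2 * Real.pi * (b⁻¹ * ξ)| ^ (2 * σ) := by
      rw [← Real.mul_rpow hb.le (abs_nonneg _)]
      congr 1
      have e : 2 * Real.pi * ξ = b * (2 * Real.pi * (b⁻¹ * ξ)) := by field_simp
      conv_lhs => rw [e, abs_mul, abs_of_pos hb]
    simp only [hF, hG, norm_mul, mul_pow, Complex.norm_real, Real.norm_eq_abs, sq_abs,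
      sobolevWeight_sq, h1]
    ring
  have hF2 : MemLp F 2 volume := by
    rw [memLp_two_iff_integrable_sq_norm hFm]
    simp_rw [hFG]
    exact hGi.comp_mul_left' hb'
  refine ⟨hF2.toLp F, ?_, ?_⟩
  · rw [L2R.norm_toLp_sq]
    simp_rw [hFG]
    rw [Measure.integral_comp_mul_left G, inv_inv, abs_of_pos hb, hG, integral_const_mul,
      integral_add f.integrable_norm_sq ((integrable_rpow_mul_norm_sq σ g).const_mul _),
      integral_const_mul, ← L2R.norm_sq_eq_integral, norm_besselOp_eq, smul_eq_mul]
    field_simp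
    rw [hf]
  · have hdil : ∀ᵐ x, besselOp σ (hF2.toLp F) x = besselOp σ g (b * x) := by
      refine fourierInv_dilation f (mulOp _ (memLp_top_besselSymbol σ) (hF2.toLp F)) hb ?_
      filter_upwards [mulOp_ae (memLp_top_besselSymbol σ) (hF2.toLp F), hF2.coeFn_toLp]
        with ξ h1 h2
      have h0 : (sobolevWeight σ ξ : ℂ) ≠ 0 := by exact_mod_cast (sobolevWeight_pos σ ξ).ne'
      rw [h1, h2, besselSymbol, Complex.ofReal_inv, inv_mul_cancel_left₀ h0]
    have h3 : quartic σ (hF2.toLp F) = ∫ x, (fun z ↦ ‖besselOp σ g z‖ ^ 4) (b * x) := by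
      refine integral_congr_ae ?_
      filter_upwards [hdil] with x hx
      rw [hx]
    rw [h3, Measure.integral_comp_mul_left (fun z ↦ ‖besselOp σ g z‖ ^ 4), abs_of_pos (inv_pos.2 hb), smul_eq_mul, quartic]

end Symmetries

/-! ### Existence of a maximizer for the embedding into `L⁴`. -/

section Maximizer

theorem quartic_eq_zero_iff {σ : ℝ} (hσ : 1 / 4 < σ) (hσ' : σ ≤ 1) {g : L2R} :
    quartic σ g = 0 ↔ g = 0 := by
  refine ⟨fun h ↦ ?_, fun h ↦ by
    have := quartic_smul σ 0 (0 : L2R)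
    simpa [h] using this⟩
  have h4 := memLp_four_besselOp hσ hσ' g
  rw [quartic, integral_norm_pow_four h4] at h
  have h1 := (ENNReal.toReal_eq_zero_iff _).1 (pow_eq_zero_iff (by norm_num) |>.1 h)
  have h2 := h1.resolve_right h4.2.ne
  rw [eLpNorm_eq_zero_iff h4.1 (by norm_num)] at h2
  have h3 : besselOp σ g = 0 := (Lp.eq_zero_iff_ae_eq_zero).2 h2
  have h5 : mulOp (besselSymbol σ) (memLp_top_besselSymbol σ) g = 0 := by
    rw [← norm_eq_zero, ← norm_besselOp_eq, h3, norm_zero]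
  rw [Lp.eq_zero_iff_ae_eq_zero] at h5 ⊢
  filter_upwards [h5, norm_sq_eq_sobolevWeight_sq_mul σ g] with ξ h6 h7
  rw [h6] at h7
  simpa using h7

theorem exists_L2R_norm_eq_one : ∃ g : L2R, ‖g‖ = 1 := by
  have hm : MemLp ((Set.Ioc (0 : ℝ) 1).indicator fun _ ↦ (1 : ℂ)) 2 volume :=
    memLp_indicator_const 2 measurableSet_Ioc _ (Or.inr (by simp))
  have : ‖hm.toLp _‖ ^ 2 = 1 := by
    rw [L2R.norm_toLp_sq]
    have e : (fun x : ℝ ↦ ‖(Set.Ioc (0 : ℝ) 1).indicator (fun _ ↦ (1 : ℂ)) x‖ ^ 2)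
        = (Set.Ioc (0 : ℝ) 1).indicator fun _ ↦ (1 : ℝ) := by
      ext x
      by_cases h : x ∈ Set.Ioc (0 : ℝ) 1
      · simp only [Set.indicator_of_mem h]; simp
      · simp only [Set.indicator_of_notMem h]; simp
    rw [e, integral_indicator measurableSet_Ioc]
    simp
  exact ⟨_, (pow_eq_one_iff_of_nonneg (norm_nonneg _) two_ne_zero).1 this⟩

theorem L2R.separableSpace : TopologicalSpace.SeparableSpace L2R := by
  have : Fact ((2 : ℝ≥0∞) ≠ ∞) := ⟨by norm_num⟩
  infer_instance

/-- The embedding `H^σ → L⁴` attains its norm. -/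
theorem exists_quartic_maximizer {σ : ℝ} (hσ : 1 / 4 < σ) (hσ' : σ ≤ 1) :
    ∃ g : L2R, ‖g‖ = 1 ∧ 0 < quartic σ g ∧ ∀ h, quartic σ h ≤ quartic σ g * ‖h‖ ^ 4 := by
  set A : Set ℝ := quartic σ '' Metric.closedBall 0 1 with hA
  set S := sSup A with hS
  have hbdd : BddAbove A := by
    refine ⟨(eLpNorm (besselSymbol σ) 4 volume).toReal ^ 4, ?_⟩
    rintro _ ⟨g, hg, rfl⟩
    rw [mem_closedBall_zero_iff] at hg
    rw [quartic, integral_norm_pow_four (memLp_four_besselOp hσ hσ' g)]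
    refine pow_le_pow_left₀ ENNReal.toReal_nonneg (ENNReal.toReal_mono
      (memLp_four_besselSymbol hσ hσ').2.ne ((eLpNorm_besselOp_le hσ hσ' g).trans ?_)) 4
    refine mul_le_of_le_one_right zero_le ?_
    rw [← ofReal_norm]
    exact ENNReal.ofReal_le_one.2 hg
  have hle : ∀ h, quartic σ h ≤ S * ‖h‖ ^ 4 := by
    intro h
    rcases eq_or_ne h 0 with rfl | h0
    · simp [(quartic_eq_zero_iff hσ hσ').2 rfl]
    have hn : 0 < ‖h‖ := norm_pos_iff.2 h0
    have h1 : quartic σ (((‖h‖⁻¹ : ℝ) : ℂ) • h) ≤ S := by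
      refine le_csSup hbdd ⟨_, ?_, rfl⟩
      rw [mem_closedBall_zero_iff, norm_smul, Complex.norm_real, norm_inv, norm_norm,
        inv_mul_cancel₀ hn.ne']
    rw [quartic_smul, Complex.norm_real, norm_inv, norm_norm, inv_pow,
      inv_mul_le_iff₀ (by positivity)] at h1
    linarith
  have hSpos : 0 < S := by
    obtain ⟨e, he⟩ := exists_L2R_norm_eq_one
    have h1 := hle e
    rw [he, one_pow, mul_one] at h1
    refine lt_of_lt_of_le (lt_of_le_of_ne (quartic_nonneg σ e) fun h ↦ ?_) h1
    rw [(quartic_eq_zero_iff hσ hσ').1 h.symm, norm_zero] at he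
    exact zero_ne_one he
  have hAne : A.Nonempty := ⟨_, 0, by simp, rfl⟩
  -- The fourth root of `S / 2`, a lower bound for the `L⁴` norm once the quartic value exceeds `S /
  -- 2`.
  set c : ℝ := √√(S / 2) with hc
  have hc4 : c ^ 4 = S / 2 := by
    have : c ^ 4 = (c ^ 2) ^ 2 := by ring
    rw [this, hc, Real.sq_sqrt (by positivity), Real.sq_sqrt (by positivity)]
  have hcpos : 0 < c := Real.sqrt_pos.2 (Real.sqrt_pos.2 (by positivity))
  obtain ⟨δ, N, hδ, hvan⟩ := exists_le_norm_inner_lowKernel hσ hσ' hcpos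
  have hseq : ∀ n : ℕ, ∃ g : L2R, ‖g‖ ≤ 1 ∧ S - 1 / ((n : ℝ) + 1) ≤ quartic σ g ∧
      δ ≤ ‖inner ℂ (lowKernel σ N 0) g‖ := by
    intro n
    obtain ⟨_, ⟨g, hg, rfl⟩, hlt⟩ := exists_lt_of_lt_csSup hAne
      (show max (S / 2) (S - 1 / ((n : ℝ) + 1)) < S from max_lt (by linarith)
        (by have : 0 < 1 / ((n : ℝ) + 1) := by positivity
            linarith))
    rw [mem_closedBall_zero_iff] at hg
    obtain ⟨y, hy⟩ := hvan g hg (by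
      refine (pow_le_pow_iff_left₀ hcpos.le ENNReal.toReal_nonneg four_ne_zero).1 ?_
      rw [hc4, ← integral_norm_pow_four (memLp_four_besselOp hσ hσ' g)]
      exact (le_max_left _ _).trans hlt.le)
    -- Modulation translates `besselOp σ g`, moving the point `y` where its low part is large to the
    -- origin and keeping the quartic value.
    refine ⟨modulation y g, (norm_modulation_le y g).trans hg, ?_, ?_⟩
    · rw [quartic_modulation]
      exact (le_max_right _ _).trans hlt.le
    · rwa [← inner_lowKernel_eq_modulation]
  choose G hG1 hG2 hG3 using hseq
  have := L2R.separableSpace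
  obtain ⟨φ, hφ, g, hw⟩ := exists_subseq_weak_tendsto hG1
  have hg1 : ‖g‖ ≤ 1 := by
    have h1 := (hw g).norm
    have h2 : ‖inner ℂ g g‖ ≤ ‖g‖ * 1 := le_of_tendsto h1 (Eventually.of_forall fun n ↦
      (norm_inner_le_norm _ _).trans (mul_le_mul_of_nonneg_left (hG1 _) (norm_nonneg _)))
    rw [inner_self_eq_norm_sq_to_K, norm_pow, RCLike.norm_ofReal, abs_norm] at h2
    by_contra! hcon
    nlinarith
  -- After recentring, the lower bound `δ` concerns the single test vector `lowKernel σ N 0` and so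
  -- survives weak convergence.
  have hg0 : 0 < ‖g‖ := by
    have h1 : δ ≤ ‖inner ℂ (lowKernel σ N 0) g‖ :=
      ge_of_tendsto (hw (lowKernel σ N 0)).norm (Eventually.of_forall fun n ↦ hG3 _)
    rw [norm_pos_iff]
    rintro rfl
    rw [inner_zero_right, norm_zero] at h1
    linarith
  set r : ℕ → L2R := fun n ↦ G (φ n) - g with hr
  have hr2 : ∀ n, ‖r n‖ ≤ 2 := fun n ↦ by
    refine (norm_sub_le _ _).trans ?_
    linarith [hG1 (φ n)]
  have hrw : ∀ y : L2R, Tendsto (fun n ↦ inner ℂ y (r n)) atTop (𝓝 0) := fun y ↦ by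
    have := (hw y).sub_const (inner ℂ y g)
    rw [sub_self] at this
    exact this.congr fun n ↦ (inner_sub_right _ _ _).symm
  have hu := memLp_four_besselOp hσ hσ' g
  set X : ℕ → ℝ := fun n ↦ ∫ x, ‖besselOp σ g x‖ ^ 2 * ‖besselOp σ (r n) x‖ ^ 2 with hX
  have hX0 : Tendsto X atTop (𝓝 0) :=
    tendsto_integral_norm_sq_mul_besselOp hσ hσ' (besselOp σ g) hu hr2 hrw
  have hrq : ∀ n, quartic σ (r n) ≤ S * 2 ^ 4 := fun n ↦
    (hle _).trans (mul_le_mul_of_nonneg_left (pow_le_pow_left₀ (norm_nonneg _) (hr2 n) 4) hSpos.le)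
  have hXn : ∀ n, 0 ≤ X n := fun n ↦ integral_nonneg fun x ↦ by positivity
  -- Brezis–Lieb for `G (φ n) = g + r n`. The squared bracket bounds `‖r n‖²` and tends to `1 -
  -- ‖g‖²`; the last line consists of cross terms that vanish with `X n`.
  have hmain : ∀ n, S - 1 / ((φ n : ℝ) + 1) ≤ quartic σ g
      + S * (1 - 2 * (inner ℂ g (G (φ n))).re + ‖g‖ ^ 2) ^ 2
      + (4 * √(quartic σ g * X n) + 6 * X n + 4 * √(S * 2 ^ 4 * X n)) := by
    intro n
    have h1 := (abs_le.1 (abs_integral_norm_add_pow_four_sub_le hu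
      (memLp_four_besselOp hσ hσ' (r n)))).2
    have h2 : quartic σ (G (φ n)) = ∫ x, ‖besselOp σ g x + besselOp σ (r n) x‖ ^ 4 := by
      have h3 : G (φ n) = g + r n := by simp [hr]
      rw [quartic]
      refine integral_congr_ae ?_
      filter_upwards [Lp.coeFn_add (besselOp σ g) (besselOp σ (r n))] with x hx
      rw [h3, map_add, hx, Pi.add_apply]
    rw [← h2] at h1
    have h4 : ‖r n‖ ^ 2 ≤ 1 - 2 * (inner ℂ g (G (φ n))).re + ‖g‖ ^ 2 := by
      rw [hr]
      simp only
      rw [@norm_sub_sq ℂ, ← inner_conj_symm, RCLike.conj_re]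
      have := pow_le_one₀ (n := 2) (norm_nonneg _) (hG1 (φ n))
      simp only [RCLike.re_to_complex]
      linarith
    have h5 : quartic σ (r n) ≤ S * (1 - 2 * (inner ℂ g (G (φ n))).re + ‖g‖ ^ 2) ^ 2 := by
      refine (hle _).trans (mul_le_mul_of_nonneg_left ?_ hSpos.le)
      have : ‖r n‖ ^ 4 = (‖r n‖ ^ 2) ^ 2 := by ring
      rw [this]
      exact pow_le_pow_left₀ (by positivity) h4 2
    have h6 : √(quartic σ (r n) * X n) ≤ √(S * 2 ^ 4 * X n) :=
      Real.sqrt_le_sqrt (mul_le_mul_of_nonneg_right (hrq n) (hXn n))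
    change quartic σ (G (φ n)) - quartic σ g - quartic σ (r n)
      ≤ 4 * √(quartic σ g * X n) + 6 * X n + 4 * √(quartic σ (r n) * X n) at h1
    have h7 : quartic σ (G (φ n)) ≤ quartic σ g + quartic σ (r n)
        + (4 * √(quartic σ g * X n) + 6 * X n + 4 * √(quartic σ (r n) * X n)) := by linarith only [h1]
    refine (hG2 (φ n)).trans (h7.trans ?_)
    gcongr
  set t := ‖g‖ ^ 2 with ht
  have hlim : S ≤ quartic σ g + S * (1 - t) ^ 2 := by
    have l1 : Tendsto (fun n ↦ S - 1 / ((φ n : ℝ) + 1)) atTop (𝓝 (S - 0)) :=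
      (tendsto_one_div_add_atTop_nhds_zero_nat.comp hφ.tendsto_atTop).const_sub S
    have l2 : Tendsto (fun n ↦ (inner ℂ g (G (φ n))).re) atTop (𝓝 t) := by
      have := (Complex.continuous_re.tendsto _).comp (hw g)
      have e : (inner ℂ g g).re = t := by
        rw [inner_self_eq_norm_sq_to_K, ht]
        norm_cast
      rwa [e] at this
    have l3 : Tendsto (fun n ↦ 4 * √(quartic σ g * X n) + 6 * X n + 4 * √(S * 2 ^ 4 * X n)) atTop
        (𝓝 (4 * √(quartic σ g * 0) + 6 * 0 + 4 * √(S * 2 ^ 4 * 0))) :=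
      (((hX0.const_mul _).sqrt.const_mul _).add (hX0.const_mul _)).add
        ((hX0.const_mul _).sqrt.const_mul _)
    have l4 := ((((l2.const_mul 2).const_sub 1).add_const t).pow 2).const_mul S
    have := le_of_tendsto_of_tendsto' l1 ((l4.const_add (quartic σ g)).add l3) hmain
    simp only [mul_zero, Real.sqrt_zero, add_zero, sub_zero] at this
    refine this.trans (le_of_eq ?_)
    ring
  have hgq := hle g
  have hg4 : ‖g‖ ^ 4 = t ^ 2 := by rw [ht]; ring
  rw [hg4] at hgq
  have ht0 : 0 < t := by positivity
  have ht1 : t ≤ 1 := pow_le_one₀ (norm_nonneg _) hg1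
  -- Combining `hlim` with `quartic σ g ≤ S t²` gives `S ≤ S (1 - 2 t (1 - t))`, impossible for `0 <
  -- t < 1`.
  have ht2 : t = 1 := by
    refine le_antisymm ht1 ?_
    by_contra! hlt
    nlinarith [mul_pos hSpos (mul_pos ht0 (sub_pos.2 hlt))]
  have hgS : quartic σ g = S := by
    rw [ht2] at hlim hgq
    refine le_antisymm ?_ ?_ <;> linarith
  refine ⟨g, (pow_eq_one_iff_of_nonneg (norm_nonneg _) two_ne_zero).1 ht2, ?_, ?_⟩
  · rwa [hgS]
  · rwa [hgS]

end Maximizer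

/-! ### Passing to a real-valued maximizer. -/

section RealMaximizer

/-- Square the pointwise identity and integrate. The value at `g₁` is left unestimated: when the
total equals `S (‖g₁‖² + ‖g₂‖²)²`, the inequality forces `quartic σ g₁ ≥ S ‖g₁‖⁴`. -/
theorem quartic_sum_le {σ : ℝ} (hσ : 1 / 4 < σ) (hσ' : σ ≤ 1) {g g₁ g₂ : L2R} {S : ℝ}
    (hS : 0 ≤ S) (hle : ∀ h, quartic σ h ≤ S * ‖h‖ ^ 4)
    (hsplit : ∀ᵐ x, ‖besselOp σ g x‖ ^ 2 = ‖besselOp σ g₁ x‖ ^ 2 + ‖besselOp σ g₂ x‖ ^ 2) :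
    quartic σ g ≤ quartic σ g₁ + 2 * (S * (‖g₁‖ ^ 2 * ‖g₂‖ ^ 2)) + S * ‖g₂‖ ^ 4 := by
  have h1 := memLp_four_besselOp hσ hσ' g₁
  have h2 := memLp_four_besselOp hσ hσ' g₂
  have i1 := integrable_norm_pow_four h1
  have i2 := integrable_norm_pow_four h2
  have i3 := integrable_norm_sq_mul_norm_sq h1 h2
  have e : quartic σ g = quartic σ g₁ + 2 * (∫ x, ‖besselOp σ g₁ x‖ ^ 2 * ‖besselOp σ g₂ x‖ ^ 2)
      + quartic σ g₂ := by
    have j1 : Integrable fun x ↦ ‖besselOp σ g₁ x‖ ^ 4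
        + 2 * (‖besselOp σ g₁ x‖ ^ 2 * ‖besselOp σ g₂ x‖ ^ 2) := i1.add (i3.const_mul 2)
    rw [quartic, quartic, quartic, ← integral_const_mul, ← integral_add i1 (i3.const_mul 2),
      ← integral_add j1 i2]
    refine integral_congr_ae ?_
    filter_upwards [hsplit] with x hx
    have : ‖besselOp σ g x‖ ^ 4 = (‖besselOp σ g x‖ ^ 2) ^ 2 := by ring
    rw [this, hx]
    ring
  have hI : ∫ x, ‖besselOp σ g₁ x‖ ^ 2 * ‖besselOp σ g₂ x‖ ^ 2 ≤ S * (‖g₁‖ ^ 2 * ‖g₂‖ ^ 2) := by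
    refine (pow_le_pow_iff_left₀ (integral_nonneg fun x ↦ by positivity) (by positivity)
      two_ne_zero).1 ((integral_norm_sq_mul_norm_sq_sq_le h1 h2).trans ?_)
    refine (mul_le_mul (hle g₁) (hle g₂) (quartic_nonneg σ g₂) (by positivity)).trans (le_of_eq ?_)
    ring
  linarith [hle g₂]

theorem exists_real_quartic_maximizer {σ : ℝ} (hσ : 1 / 4 < σ) (hσ' : σ ≤ 1) :
    ∃ g : L2R, ‖g‖ = 1 ∧ 0 < quartic σ g ∧ (∀ h, quartic σ h ≤ quartic σ g * ‖h‖ ^ 4) ∧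
      ∀ᵐ x, (besselOp σ g x).im = 0 := by
  obtain ⟨g, hg1, hpos, hle⟩ := exists_quartic_maximizer hσ hσ'
  obtain ⟨h, hh, hconj⟩ := exists_besselOp_eq_conj σ g
  set S := quartic σ g with hS
  have key : ∀ f : L2R, f ≠ 0 → quartic σ f = S * ‖f‖ ^ 4 → (∀ᵐ x, (besselOp σ f x).im = 0) →
      ∃ g : L2R, ‖g‖ = 1 ∧ 0 < quartic σ g ∧ (∀ h, quartic σ h ≤ quartic σ g * ‖h‖ ^ 4) ∧
        ∀ᵐ x, (besselOp σ g x).im = 0 := by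
    intro f hf0 hfS hfr
    have hn : 0 < ‖f‖ := norm_pos_iff.2 hf0
    have hq : quartic σ (((‖f‖⁻¹ : ℝ) : ℂ) • f) = S := by
      rw [quartic_smul, hfS, Complex.norm_real, norm_inv, norm_norm]
      field_simp
    refine ⟨((‖f‖⁻¹ : ℝ) : ℂ) • f, ?_, by rwa [hq], by rwa [hq], ?_⟩
    · rw [norm_smul, Complex.norm_real, norm_inv, norm_norm, inv_mul_cancel₀ hn.ne']
    · rw [map_smul]
      filter_upwards [hfr, Lp.coeFn_smul ((‖f‖⁻¹ : ℝ) : ℂ) (besselOp σ f)] with x h1 h2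
      rw [h2, Pi.smul_apply, smul_eq_mul, Complex.im_ofReal_mul, h1, mul_zero]
  -- The preimages of the real and imaginary parts of `besselOp σ g`; since `‖h‖ = ‖g‖`, the
  -- parallelogram law makes their squared norms add up to 1.
  set g₁ : L2R := (1 / 2 : ℂ) • (g + h) with hg₁
  set g₂ : L2R := (-Complex.I / 2) • (g - h) with hg₂
  have hu₁ : ∀ᵐ x, besselOp σ g₁ x = ((besselOp σ g x).re : ℂ) := by
    rw [hg₁, map_smul, map_add]
    filter_upwards [hconj, Lp.coeFn_smul (1 / 2 : ℂ) (besselOp σ g + besselOp σ h),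
      Lp.coeFn_add (besselOp σ g) (besselOp σ h)] with x h1 h2 h3
    rw [h2, Pi.smul_apply, h3, Pi.add_apply, h1, Complex.add_conj, smul_eq_mul]
    push_cast
    ring
  have hu₂ : ∀ᵐ x, besselOp σ g₂ x = ((besselOp σ g x).im : ℂ) := by
    rw [hg₂, map_smul, map_sub]
    filter_upwards [hconj, Lp.coeFn_smul (-Complex.I / 2) (besselOp σ g - besselOp σ h),
      Lp.coeFn_sub (besselOp σ g) (besselOp σ h)] with x h1 h2 h3
    rw [h2, Pi.smul_apply, h3, Pi.sub_apply, h1, Complex.sub_conj, smul_eq_mul]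
    push_cast
    linear_combination (-(besselOp σ g x).im : ℂ) * Complex.I_mul_I
  have hsplit : ∀ᵐ x, ‖besselOp σ g x‖ ^ 2
      = ‖besselOp σ g₁ x‖ ^ 2 + ‖besselOp σ g₂ x‖ ^ 2 := by
    filter_upwards [hu₁, hu₂] with x h1 h2
    rw [h1, h2, Complex.norm_real, Complex.norm_real, Real.norm_eq_abs, Real.norm_eq_abs, sq_abs,
      sq_abs, Complex.sq_norm, Complex.normSq_apply]
    ring
  have hpq : ‖g₁‖ ^ 2 + ‖g₂‖ ^ 2 = 1 := by
    have h1 := parallelogram_law_with_norm ℂ g h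
    rw [hh, hg1] at h1
    rw [hg₁, hg₂, norm_smul, norm_smul]
    simp only [norm_div, norm_one, norm_neg, Complex.norm_I, Complex.norm_ofNat, mul_pow]
    linarith
  have hA := quartic_sum_le hσ hσ' hpos.le hle hsplit
  have hB := quartic_sum_le hσ hσ' hpos.le hle (g₁ := g₂) (g₂ := g₁)
    (hsplit.mono fun x hx ↦ by rw [hx, add_comm])
  have hone : S * (‖g₁‖ ^ 2 + ‖g₂‖ ^ 2) ^ 2 = S := by rw [hpq, one_pow, mul_one]
  by_cases h0 : g₁ = 0
  · have h02 : g₂ ≠ 0 := by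
      rintro h02
      rw [h0, h02] at hpq
      simp at hpq
    refine key g₂ h02 (le_antisymm (hle g₂) ?_) (hu₂.mono fun x hx ↦ by rw [hx, Complex.ofReal_im])
    nlinarith
  · refine key g₁ h0 (le_antisymm (hle g₁) ?_) (hu₁.mono fun x hx ↦ by rw [hx, Complex.ofReal_im])
    nlinarith

end RealMaximizer

/-! ### First variation at a maximizer. -/

section EulerLagrange

theorem linear_coeff_eq_zero_of_nonneg {c₁ c₂ c₃ c₄ : ℝ}
    (h : ∀ t : ℝ, 0 ≤ c₁ * t + c₂ * t ^ 2 + c₃ * t ^ 3 + c₄ * t ^ 4) : c₁ = 0 := by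
  have hd : HasDerivAt (fun t : ℝ ↦ c₁ * t + c₂ * t ^ 2 + c₃ * t ^ 3 + c₄ * t ^ 4) c₁ 0 := by
    have := ((((hasDerivAt_id (0 : ℝ)).const_mul c₁).add
      ((hasDerivAt_pow 2 (0 : ℝ)).const_mul c₂)).add
      ((hasDerivAt_pow 3 (0 : ℝ)).const_mul c₃)).add ((hasDerivAt_pow 4 (0 : ℝ)).const_mul c₄)
    exact this.congr_deriv (by simp)
  refine IsLocalMin.hasDerivAt_eq_zero (Eventually.of_forall fun t ↦ ?_) hd
  simpa using h t

theorem quartic_maximizer_variation {σ : ℝ} (hσ : 1 / 4 < σ) (hσ' : σ ≤ 1) {g : L2R}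
    (hg : ‖g‖ = 1) (hle : ∀ h, quartic σ h ≤ quartic σ g * ‖h‖ ^ 4) (h : L2R) :
    quartic σ g * (inner ℂ h g).re
      = ∫ x, ‖besselOp σ g x‖ ^ 2 * (conj (besselOp σ g x) * besselOp σ h x).re := by
  set S := quartic σ g with hS
  have hu := memLp_four_besselOp hσ hσ' g
  have hv := memLp_four_besselOp hσ hσ' h
  set J := ∫ x, ‖besselOp σ g x‖ ^ 2 * (conj (besselOp σ g x) * besselOp σ h x).re with hJ
  set R := (inner ℂ h g).re with hR
  have hnorm : ∀ t : ℝ, ‖g + (t : ℂ) • h‖ ^ 2 = 1 + 2 * t * R + t ^ 2 * ‖h‖ ^ 2 := by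
    intro t
    rw [@norm_add_sq ℂ, hg, norm_smul, Complex.norm_real, mul_pow, Real.norm_eq_abs, sq_abs,
      ← inner_conj_symm, RCLike.conj_re, inner_smul_left, Complex.conj_ofReal,
      RCLike.re_to_complex, Complex.re_ofReal_mul]
    ring
  have hq : ∀ t : ℝ, quartic σ (g + (t : ℂ) • h)
      = ∫ x, ‖besselOp σ g x + t * besselOp σ h x‖ ^ 4 := by
    intro t
    refine integral_congr_ae ?_
    filter_upwards [Lp.coeFn_add (besselOp σ g) ((t : ℂ) • besselOp σ h),
      Lp.coeFn_smul (t : ℂ) (besselOp σ h)] with x h1 h2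
    rw [map_add, map_smul, h1, Pi.add_apply, h2, Pi.smul_apply, smul_eq_mul]
  have hpoly := fun t : ℝ ↦ integral_norm_add_ofReal_mul_pow_four hu hv t
  set K := ∫ x, (4 * (conj (besselOp σ g x) * besselOp σ h x).re ^ 2
    + 2 * (‖besselOp σ g x‖ ^ 2 * ‖besselOp σ h x‖ ^ 2)) with hK
  set L := ∫ x, ‖besselOp σ h x‖ ^ 2 * (conj (besselOp σ g x) * besselOp σ h x).re with hL
  set M := ∫ x, ‖besselOp σ h x‖ ^ 4 with hM
  have hS' : S = ∫ x, ‖besselOp σ g x‖ ^ 4 := rfl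
  -- These are the coefficients of `S ‖g + t h‖⁴ - quartic σ (g + t h)`, nonnegative in `t` and zero
  -- at `t = 0`.
  have := linear_coeff_eq_zero_of_nonneg (c₁ := 4 * S * R - 4 * J)
    (c₂ := S * (4 * R ^ 2 + 2 * ‖h‖ ^ 2) - K) (c₃ := S * (4 * R * ‖h‖ ^ 2) - 4 * L)
    (c₄ := S * ‖h‖ ^ 4 - M) fun t ↦ by
      have h1 := hle (g + (t : ℂ) • h)
      have h2 : ‖g + (t : ℂ) • h‖ ^ 4 = (1 + 2 * t * R + t ^ 2 * ‖h‖ ^ 2) ^ 2 := by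
        rw [← hnorm]; ring
      rw [hq, hpoly, h2, ← hS'] at h1
      have h3 : (4 * S * R - 4 * J) * t + (S * (4 * R ^ 2 + 2 * ‖h‖ ^ 2) - K) * t ^ 2
          + (S * (4 * R * ‖h‖ ^ 2) - 4 * L) * t ^ 3 + (S * ‖h‖ ^ 4 - M) * t ^ 4
          = S * (1 + 2 * t * R + t ^ 2 * ‖h‖ ^ 2) ^ 2
            - (S + 4 * t * J + t ^ 2 * K + 4 * t ^ 3 * L + t ^ 4 * M) := by ring
      rw [h3]
      linarith only [h1]
  linarith

theorem integrable_pow_three_mul_conj {u v : ℝ → ℂ} (hu : MemLp u 4 (volume : Measure ℝ))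
    (hv : MemLp v 4 (volume : Measure ℝ)) : Integrable fun x ↦ u x ^ 3 * conj (v x) := by
  have h : Integrable fun x ↦ ‖u x‖ ^ 2 * (‖u x‖ * ‖v x‖) :=
    (memLp_two_norm_sq hu).integrable_mul (memLp_two_norm_mul_norm hu hv)
  refine h.mono' ((hu.1.pow 3).mul (Complex.continuous_conj.comp_aestronglyMeasurable hv.1))
    (Eventually.of_forall fun x ↦ le_of_eq ?_)
  rw [norm_mul, norm_pow, RCLike.norm_conj]
  ring

theorem quartic_maximizer_euler_lagrange {σ : ℝ} (hσ : 1 / 4 < σ) (hσ' : σ ≤ 1) {g : L2R}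
    (hg : ‖g‖ = 1) (hle : ∀ h, quartic σ h ≤ quartic σ g * ‖h‖ ^ 4)
    (hreal : ∀ᵐ x, (besselOp σ g x).im = 0) (h : L2R) :
    (quartic σ g : ℂ) * inner ℂ h g = ∫ x, besselOp σ g x ^ 3 * conj (besselOp σ h x) := by
  have hu := memLp_four_besselOp hσ hσ' g
  have hre : ∀ h : L2R, quartic σ g * (inner ℂ h g).re
      = (∫ x, besselOp σ g x ^ 3 * conj (besselOp σ h x)).re := by
    intro h
    have hint := integrable_pow_three_mul_conj hu (memLp_four_besselOp hσ hσ' h)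
    rw [quartic_maximizer_variation hσ hσ' hg hle h, ← RCLike.re_to_complex, ← integral_re hint]
    refine integral_congr_ae ?_
    filter_upwards [hreal] with x hx
    obtain ⟨a, ha⟩ : ∃ a : ℝ, besselOp σ g x = a := ⟨_, (Complex.ext rfl (by simpa using hx))⟩
    rw [ha, Complex.conj_ofReal, Complex.norm_real, Real.norm_eq_abs, sq_abs,
      Complex.re_ofReal_mul, ← Complex.ofReal_pow, RCLike.re_to_complex, Complex.re_ofReal_mul,
      Complex.conj_re]
    ring
  refine Complex.ext ?_ ?_
  · rw [Complex.re_ofReal_mul]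
    exact hre h
  -- The variation is only real-linear; testing with `i h` recovers the imaginary part.
  · have h1 := hre (Complex.I • h)
    have h2 : ∫ x, besselOp σ g x ^ 3 * conj (besselOp σ (Complex.I • h) x)
        = -Complex.I * ∫ x, besselOp σ g x ^ 3 * conj (besselOp σ h x) := by
      rw [← integral_const_mul]
      refine integral_congr_ae ?_
      filter_upwards [Lp.coeFn_smul Complex.I (besselOp σ h)] with x hx
      rw [map_smul, hx, Pi.smul_apply, smul_eq_mul, map_mul, Complex.conj_I]
      ring
    rw [h2, inner_smul_left, Complex.conj_I] at h1
    rw [Complex.im_ofReal_mul]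
    simpa using h1

end EulerLagrange

/-! ### Sobolev membership, the sharp Gagliardo–Nirenberg inequality and the Weinstein functional.
-/

section Weinstein

theorem fourier_besselOp (σ : ℝ) (g : L2R) :
    (𝓕 (besselOp σ g) : L2R) = mulOp (besselSymbol σ) (memLp_top_besselSymbol σ) g := by
  rw [besselOp_apply, FourierTransform.fourier_fourierInv_eq]

theorem norm_fracSymbolMul_sq (σ : ℝ) (u : L2R) (ξ : ℝ) :
    ‖fracSymbolMul σ u ξ‖ ^ 2 = |2 * Real.pi * ξ| ^ (2 * σ) * ‖(𝓕 u : L2R) ξ‖ ^ 2 := by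
  rw [fracSymbolMul, norm_mul, mul_pow, Complex.norm_real, Real.norm_eq_abs, sq_abs,
    ← Real.rpow_natCast (|2 * Real.pi * ξ| ^ σ) 2, ← Real.rpow_mul (abs_nonneg _)]
  congr 2
  push_cast
  ring

theorem exists_besselOp_eq {σ : ℝ} (h0 : 0 ≤ σ) {u : L2R} (hu : u ∈ SobolevH σ) :
    ∃ g, besselOp σ g = u := by
  have h1 := (memLp_two_iff_integrable_sq_norm (memLp_fracSymbolMul h0 hu).1).1
    (memLp_fracSymbolMul h0 hu)
  have hm : AEStronglyMeasurable (fun ξ ↦ (sobolevWeight σ ξ : ℂ) * (𝓕 u : L2R) ξ) volume :=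
    AEStronglyMeasurable.mul (by fun_prop) (Lp.aestronglyMeasurable _)
  have h2 : MemLp (fun ξ ↦ (sobolevWeight σ ξ : ℂ) * (𝓕 u : L2R) ξ) 2 volume := by
    rw [memLp_two_iff_integrable_sq_norm hm]
    refine ((𝓕 u : L2R).integrable_norm_sq.add h1).congr (Eventually.of_forall fun ξ ↦ ?_)
    simp only [Pi.add_apply]
    rw [norm_fracSymbolMul_sq, norm_mul, mul_pow, Complex.norm_real, Real.norm_eq_abs, sq_abs,
      sobolevWeight_sq, one_add_mul]
  refine ⟨h2.toLp _, ?_⟩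
  have h3 : mulOp (besselSymbol σ) (memLp_top_besselSymbol σ) (h2.toLp _) = (𝓕 u : L2R) := by
    apply Lp.ext
    filter_upwards [mulOp_ae (memLp_top_besselSymbol σ) (h2.toLp _), h2.coeFn_toLp] with ξ h4 h5
    have h0 : (sobolevWeight σ ξ : ℂ) ≠ 0 := by exact_mod_cast (sobolevWeight_pos σ ξ).ne'
    rw [h4, h5, besselSymbol, Complex.ofReal_inv, inv_mul_cancel_left₀ h0]
  rw [besselOp_apply, h3, FourierTransform.fourierInv_fourier_eq]

theorem besselOp_mem_sobolevH {σ : ℝ} (h0 : 0 ≤ σ) (h1 : σ ≤ 1) (g : L2R) :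
    besselOp σ g ∈ SobolevH σ := by
  have hb : MemLp (fun x : ℝ ↦ (((1 + ‖x‖ ^ 2) ^ (-σ / 2) : ℝ) : ℂ)) ∞
      (volume : Measure ℝ) := by
    have hg : (fun x : ℝ ↦ ((1 + ‖x‖ ^ 2) ^ (-σ / 2) : ℝ)).HasTemperateGrowth := by fun_prop
    refine memLp_top_of_bound (Complex.continuous_ofReal.comp hg.1.continuous).aestronglyMeasurable
      1 (Eventually.of_forall fun x ↦ ?_)
    rw [Complex.norm_real, Real.norm_of_nonneg (by positivity)]
    exact Real.rpow_le_one_of_one_le_of_nonpos (by nlinarith [sq_nonneg ‖x‖]) (by linarith)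
  have hk : MemLp (fun x : ℝ ↦ (((1 + ‖x‖ ^ 2) ^ (σ / 2) : ℝ) : ℂ) * besselSymbol σ x) ∞
      (volume : Measure ℝ) := by
    refine memLp_top_of_bound (by fun_prop) 1 (Eventually.of_forall fun x ↦ ?_)
    have hw := sobolevWeight_pos σ x
    rw [norm_mul, norm_besselSymbol, Complex.norm_real, Real.norm_of_nonneg (by positivity),
      ← div_eq_mul_inv, div_le_one hw]
    refine (pow_le_pow_iff_left₀ (by positivity) hw.le two_ne_zero).1 ?_
    refine le_trans (le_of_eq ?_) (one_add_sq_rpow_le_sobolevWeight_sq h0 h1 x)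
    rw [← Real.rpow_natCast ((1 + ‖x‖ ^ 2) ^ (σ / 2)) 2, ← Real.rpow_mul (by positivity)]
    congr 1
    push_cast
    ring
  set f := mulOp _ hk g with hf
  have hfu : (𝓕 (besselOp σ g) : L2R) = hb.toLp _ • f := by
    rw [fourier_besselOp]
    apply Lp.ext
    filter_upwards [Lp.coeFn_lpSMul (r := 2) (hb.toLp _) f, hb.coeFn_toLp, mulOp_ae hk g,
      mulOp_ae (memLp_top_besselSymbol σ) g] with x h2 h3 h4 h5
    rw [h2, Pi.smul_apply', h3, h4, h5, smul_eq_mul, ← mul_assoc, ← mul_assoc,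
      ← Complex.ofReal_mul, ← Real.rpow_add (by positivity), neg_div, neg_add_cancel,
      Real.rpow_zero, Complex.ofReal_one, one_mul]
  refine TemperedDistribution.memSobolev_iff_exists_smulLeftCLM_fourier.mpr ⟨f, ?_⟩
  rw [Lp.fourier_toTemperedDistribution_eq, hfu,
    MeasureTheory.Lp.toTemperedDistribution_smul_eq (by fun_prop),
    TemperedDistribution.smulLeftCLM_smulLeftCLM_apply (by fun_prop) (by fun_prop)]
  have h2 : ((fun x : ℝ ↦ (((1 + ‖x‖ ^ 2) ^ (σ / 2) : ℝ) : ℂ)) *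
      fun x : ℝ ↦ (((1 + ‖x‖ ^ 2) ^ (-σ / 2) : ℝ) : ℂ)) = fun _ ↦ 1 := by
    ext x
    rw [Pi.mul_apply, ← Complex.ofReal_mul, ← Real.rpow_add (by positivity), neg_div,
      add_neg_cancel, Real.rpow_zero, Complex.ofReal_one]
  rw [mul_comm, h2, TemperedDistribution.smulLeftCLM_const, one_smul]

/-- The squared seminorm `‖|∇|^σ u‖²` for `u = besselOp σ g`. -/
noncomputable def kineticEnergy (σ : ℝ) (g : L2R) : ℝ :=
  ∫ ξ, |2 * Real.pi * ξ| ^ (2 * σ)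
    * ‖mulOp (besselSymbol σ) (memLp_top_besselSymbol σ) g ξ‖ ^ 2

theorem norm_fracDeriv_besselOp_sq {σ : ℝ} (h0 : 0 ≤ σ) (h1 : σ ≤ 1) (g : L2R) :
    ‖fracDeriv σ (besselOp σ g)‖ ^ 2 = kineticEnergy σ g := by
  have hm := memLp_fracSymbolMul h0 (besselOp_mem_sobolevH h0 h1 g)
  rw [fracDeriv, dif_pos hm, norm_fourierInv_eq, L2R.norm_toLp_sq, kineticEnergy]
  simp_rw [norm_fracSymbolMul_sq, fourier_besselOp]

theorem kineticEnergy_nonneg (σ : ℝ) (g : L2R) : 0 ≤ kineticEnergy σ g :=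
  integral_nonneg fun ξ ↦ by positivity

theorem kineticEnergy_pos (σ : ℝ) {g : L2R} (hg : g ≠ 0) : 0 < kineticEnergy σ g := by
  refine lt_of_le_of_ne (kineticEnergy_nonneg σ g) fun h ↦ hg ?_
  rw [Lp.eq_zero_iff_ae_eq_zero]
  have h1 := (integral_eq_zero_iff_of_nonneg (fun ξ ↦ by positivity)
    (integrable_rpow_mul_norm_sq σ g)).1 h.symm
  filter_upwards [h1, norm_sq_eq_sobolevWeight_sq_mul σ g,
    compl_mem_ae_iff.2 (measure_singleton (0 : ℝ))] with ξ h2 h3 h4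
  have h5 : 0 < |2 * Real.pi * ξ| ^ (2 * σ) :=
    Real.rpow_pos_of_pos (abs_pos.2 (mul_ne_zero (by positivity) h4)) _
  simp only [Pi.zero_apply] at h2
  have h6 := (mul_eq_zero.1 h2).resolve_left h5.ne'
  rw [h6, mul_zero, add_zero] at h3
  simpa using h3

theorem besselOp_ne_zero {σ : ℝ} (hσ : 1 / 4 < σ) (hσ' : σ ≤ 1) {g : L2R} (hg : g ≠ 0) :
    besselOp σ g ≠ 0 := by
  intro h
  refine hg ((quartic_eq_zero_iff hσ hσ').1 ?_)
  rw [quartic, h]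
  refine integral_eq_zero_of_ae ?_
  filter_upwards [Lp.coeFn_zero ℂ 2 (volume : Measure ℝ)] with x hx
  rw [hx]
  simp

theorem weinsteinW_besselOp {σ : ℝ} (hσ : 1 / 4 < σ) (hσ' : σ ≤ 1) (g : L2R) :
    weinsteinW σ (besselOp σ g) = (‖besselOp σ g‖ ^ 2) ^ (2 - 1 / (2 * σ))
      * kineticEnergy σ g ^ (1 / (2 * σ)) / quartic σ g := by
  have hs : σ ≠ 0 := by linarith
  rw [weinsteinW, quartic, integral_norm_pow_four (memLp_four_besselOp hσ hσ' g),
    ← norm_fracDeriv_besselOp_sq (by linarith) hσ', ← Real.rpow_natCast_mul (norm_nonneg _),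
    ← Real.rpow_natCast_mul (norm_nonneg _)]
  congr 3
  · push_cast
    field_simp
    ring
  · push_cast
    field_simp

/-- Gagliardo–Nirenberg inequality with the constant inherited from `H^σ → L⁴` by optimizing over
dilations. -/
theorem quartic_le_of_forall_le {σ : ℝ} (hσ : 1 / 4 < σ) (hσ' : σ ≤ 1) {S : ℝ}
    (hle : ∀ h, quartic σ h ≤ S * ‖h‖ ^ 4) {g : L2R} (hg : g ≠ 0) :
    quartic σ g ≤ 4 * S * ((‖besselOp σ g‖ ^ 2 / (2 - 1 / (2 * σ))) ^ (2 - 1 / (2 * σ))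
      * (kineticEnergy σ g / (1 / (2 * σ))) ^ (1 / (2 * σ))) := by
  have hs : 0 < σ := by linarith
  set β := 1 / (2 * σ) with hβ
  have hβpos : 0 < β := by positivity
  have hβ2 : β < 2 := by
    rw [hβ, div_lt_iff₀ (by positivity)]
    linarith
  set α := 2 - β with hα
  have hαpos : 0 < α := by linarith
  have ha : 0 < ‖besselOp σ g‖ ^ 2 := by
    have := norm_pos_iff.2 (besselOp_ne_zero hσ hσ' hg)
    positivity
  have hb := kineticEnergy_pos σ hg
  set x := ‖besselOp σ g‖ ^ 2 / α with hx
  set y := kineticEnergy σ g / β with hy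
  have hxpos : 0 < x := div_pos ha hαpos
  have hypos : 0 < y := div_pos hb hβpos
  have hax : ‖besselOp σ g‖ ^ 2 = α * x := by rw [hx]; field_simp
  have hby : kineticEnergy σ g = β * y := by rw [hy]; field_simp
  -- The minimizer of `b⁻¹ (‖u‖² + b^{2σ} E)²`, with `u = besselOp σ g` and `E` its kinetic energy.
  -- It gives `b^{2σ} y = x`, so the bracket becomes `α x + β x = 2 x`.
  set b := (x / y) ^ β with hbdef
  have hbpos : 0 < b := by positivity
  have hb2 : b ^ (2 * σ) = x / y := by
    rw [hbdef, ← Real.rpow_mul (by positivity), hβ, one_div_mul_cancel (by positivity),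
      Real.rpow_one]
  obtain ⟨h, hh1, hh2⟩ := exists_dilation σ g hbpos
  change ‖h‖ ^ 2 = b⁻¹ * (‖besselOp σ g‖ ^ 2 + b ^ (2 * σ) * kineticEnergy σ g) at hh1
  have h1 := hle h
  have h4 : ‖h‖ ^ 4 = (b⁻¹ * (2 * x)) ^ 2 := by
    have e : ‖h‖ ^ 4 = (‖h‖ ^ 2) ^ 2 := by ring
    rw [e, hh1, hb2, hax, hby, hα]
    field_simp
    ring
  rw [hh2, h4, inv_mul_le_iff₀ hbpos] at h1
  refine h1.trans (le_of_eq ?_)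
  have h5 : x ^ α * y ^ β = b⁻¹ * x ^ 2 := by
    rw [hbdef, Real.div_rpow hxpos.le hypos.le, hα, Real.rpow_sub hxpos, Real.rpow_ofNat]
    field_simp
  rw [h5]
  field_simp
  ring

/-- Weighted AM–GM with weights `α / 2` and `β / 2`, squared, where `β = 1 / (2σ)` and `α = 2 - β`.
It goes opposite to the dilation bound with the same constant, which pins down `W` at a maximizer.
-/
theorem four_mul_rpow_le {σ : ℝ} (hσ : 1 / 4 < σ) (g : L2R) :
    4 * ((‖besselOp σ g‖ ^ 2 / (2 - 1 / (2 * σ))) ^ (2 - 1 / (2 * σ))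
      * (kineticEnergy σ g / (1 / (2 * σ))) ^ (1 / (2 * σ))) ≤ ‖g‖ ^ 4 := by
  have hs : 0 < σ := by linarith
  have hsum := norm_sq_eq_norm_besselOp_sq_add σ g
  change ‖g‖ ^ 2 = ‖besselOp σ g‖ ^ 2 + kineticEnergy σ g at hsum
  set β := 1 / (2 * σ) with hβ
  have hβpos : 0 < β := by positivity
  have hβ2 : β < 2 := by
    rw [hβ, div_lt_iff₀ (by positivity)]
    linarith
  set α := 2 - β with hα
  have hαpos : 0 < α := by linarith
  set x := ‖besselOp σ g‖ ^ 2 / α with hx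
  set y := kineticEnergy σ g / β with hy
  have hx0 : 0 ≤ x := by positivity
  have hy0 : 0 ≤ y := div_nonneg (kineticEnergy_nonneg σ g) hβpos.le
  have hax : ‖besselOp σ g‖ ^ 2 = α * x := by rw [hx]; field_simp
  have hby : kineticEnergy σ g = β * y := by rw [hy]; field_simp
  have h1 := Real.geom_mean_le_arith_mean2_weighted (w₁ := α / 2) (w₂ := β / 2) (by positivity)
    (by positivity) hx0 hy0 (by rw [hα]; ring)
  have h2 : x ^ α * y ^ β = (x ^ (α / 2) * y ^ (β / 2)) ^ 2 := by
    rw [mul_pow, ← Real.rpow_mul_natCast hx0, ← Real.rpow_mul_natCast hy0]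
    congr 2 <;> push_cast <;> ring
  have h3 : α / 2 * x + β / 2 * y = ‖g‖ ^ 2 / 2 := by
    rw [hsum, hax, hby]
    ring
  rw [h3] at h1
  have h4 := pow_le_pow_left₀ (by positivity) h1 2
  rw [h2]
  calc 4 * (x ^ (α / 2) * y ^ (β / 2)) ^ 2 ≤ 4 * (‖g‖ ^ 2 / 2) ^ 2 := by gcongr
    _ = ‖g‖ ^ 4 := by ring

/-- Both values are compared with `α^α β^β / (4 S)`: it bounds `W` from below everywhere by
Gagliardo–Nirenberg, and from above at `q` by `four_mul_rpow_le`. -/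
theorem weinsteinW_besselOp_le_of_maximizer {σ : ℝ} (hσ : 1 / 4 < σ) (hσ' : σ ≤ 1) {S : ℝ}
    (hS : 0 < S) (hle : ∀ h, quartic σ h ≤ S * ‖h‖ ^ 4) {q g : L2R} (hq : q ≠ 0)
    (hqS : quartic σ q = S * ‖q‖ ^ 4) (hg : g ≠ 0) :
    weinsteinW σ (besselOp σ q) ≤ weinsteinW σ (besselOp σ g) := by
  have hs : 0 < σ := by linarith
  have hpos : ∀ f : L2R, f ≠ 0 → 0 < quartic σ f := fun f hf ↦
    lt_of_le_of_ne (quartic_nonneg σ f) fun h ↦ hf ((quartic_eq_zero_iff hσ hσ').1 h.symm)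
  have h1 := four_mul_rpow_le hσ q
  have h2 := quartic_le_of_forall_le hσ hσ' hle hg
  rw [weinsteinW_besselOp hσ hσ', weinsteinW_besselOp hσ hσ',
    div_le_div_iff₀ (hpos q hq) (hpos g hg), hqS]
  have hβpos : 0 < 1 / (2 * σ) := by positivity
  have hβ2 : 1 / (2 * σ) < 2 := by
    rw [div_lt_iff₀ (by positivity)]
    linarith
  set β := 1 / (2 * σ) with hβ
  set α := 2 - β with hα
  have hαpos : 0 < α := by linarith
  have hfac : ∀ f : L2R, (‖besselOp σ f‖ ^ 2) ^ α * kineticEnergy σ f ^ β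
      = (α ^ α * β ^ β) * ((‖besselOp σ f‖ ^ 2 / α) ^ α * (kineticEnergy σ f / β) ^ β) := by
    intro f
    rw [Real.div_rpow (by positivity) hαpos.le, Real.div_rpow (kineticEnergy_nonneg σ f) hβpos.le]
    have := Real.rpow_pos_of_pos hαpos α
    have := Real.rpow_pos_of_pos hβpos β
    field_simp
  rw [hfac q, hfac g]
  have hV : 0 ≤ (‖besselOp σ q‖ ^ 2 / α) ^ α * (kineticEnergy σ q / β) ^ β :=
    mul_nonneg (by positivity)
      (Real.rpow_nonneg (div_nonneg (kineticEnergy_nonneg σ q) hβpos.le) _)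
  have hV' : 0 ≤ (‖besselOp σ g‖ ^ 2 / α) ^ α * (kineticEnergy σ g / β) ^ β :=
    mul_nonneg (by positivity)
      (Real.rpow_nonneg (div_nonneg (kineticEnergy_nonneg σ g) hβpos.le) _)
  set V := (‖besselOp σ q‖ ^ 2 / α) ^ α * (kineticEnergy σ q / β) ^ β
  set V' := (‖besselOp σ g‖ ^ 2 / α) ^ α * (kineticEnergy σ g / β) ^ β
  have hK : 0 ≤ α ^ α * β ^ β := by positivity
  rw [mul_assoc (α ^ α * β ^ β), mul_assoc (α ^ α * β ^ β)]
  refine mul_le_mul_of_nonneg_left ?_ hK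
  calc V * quartic σ g ≤ V * (4 * S * V') := mul_le_mul_of_nonneg_left h2 hV
    _ = (4 * V) * (S * V') := by ring
    _ ≤ ‖q‖ ^ 4 * (S * V') := mul_le_mul_of_nonneg_right h1 (by positivity)
    _ = V' * (S * ‖q‖ ^ 4) := by ring

/-- By Plancherel the linear part of the equation is the `H^σ` inner product, which `besselOp σ`
pulls back to that of `L²`. -/
theorem inner_besselOp_add_kinetic (σ : ℝ) (g h : L2R) :
    (∫ ξ : ℝ, ((|2 * Real.pi * ξ| ^ (2 * σ) : ℝ) : ℂ) * (𝓕 (besselOp σ g) : L2R) ξ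
        * conj ((𝓕 (besselOp σ h) : L2R) ξ))
      + (∫ x : ℝ, besselOp σ g x * conj (besselOp σ h x)) = inner ℂ h g := by
  have e1 : ∫ x : ℝ, besselOp σ g x * conj (besselOp σ h x)
      = ∫ ξ, (𝓕 (besselOp σ g) : L2R) ξ * conj ((𝓕 (besselOp σ h) : L2R) ξ) := by
    have := Lp.inner_fourier_eq (besselOp σ h) (besselOp σ g)
    rw [L2.inner_def, L2.inner_def] at this
    simp only [RCLike.inner_apply] at this
    exact this.symm
  have i0 : Integrable fun ξ ↦ inner ℂ (h ξ) (g ξ) := L2.integrable_inner h g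
  have i1 : Integrable fun ξ ↦
      (𝓕 (besselOp σ g) : L2R) ξ * conj ((𝓕 (besselOp σ h) : L2R) ξ) := by
    have := L2.integrable_inner (𝕜 := ℂ) (𝓕 (besselOp σ h) : L2R) (𝓕 (besselOp σ g) : L2R)
    simpa only [RCLike.inner_apply] using this
  have hae : ∀ᵐ ξ, inner ℂ (h ξ) (g ξ) = ((|2 * Real.pi * ξ| ^ (2 * σ) : ℝ) : ℂ)
      * (𝓕 (besselOp σ g) : L2R) ξ * conj ((𝓕 (besselOp σ h) : L2R) ξ)
      + (𝓕 (besselOp σ g) : L2R) ξ * conj ((𝓕 (besselOp σ h) : L2R) ξ) := by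
    rw [fourier_besselOp, fourier_besselOp]
    filter_upwards [mulOp_ae (memLp_top_besselSymbol σ) g,
      mulOp_ae (memLp_top_besselSymbol σ) h] with ξ h1 h2
    have h3 : (sobolevWeight σ ξ : ℂ) ^ 2 = 1 + ((|2 * Real.pi * ξ| ^ (2 * σ) : ℝ) : ℂ) := by
      exact_mod_cast sobolevWeight_sq σ ξ
    have h4 : (sobolevWeight σ ξ : ℂ) ≠ 0 := by exact_mod_cast (sobolevWeight_pos σ ξ).ne'
    rw [h1, h2, mul_assoc, ← add_one_mul, add_comm, ← h3, RCLike.inner_apply, map_mul,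
      besselSymbol, Complex.conj_ofReal, Complex.ofReal_inv]
    field_simp
  have i2 : Integrable fun ξ ↦ ((|2 * Real.pi * ξ| ^ (2 * σ) : ℝ) : ℂ)
      * (𝓕 (besselOp σ g) : L2R) ξ * conj ((𝓕 (besselOp σ h) : L2R) ξ) := by
    refine (i0.sub i1).congr ?_
    filter_upwards [hae] with ξ hξ
    rw [Pi.sub_apply, hξ, add_sub_cancel_right]
  rw [e1, ← integral_add i2 i1, L2.inner_def]
  exact (integral_congr_ae hae).symm

end Weinstein

/-! ### Conclusion: the rescaled real maximizer. -/

theorem theorem3p1 (σ : ℝ) (hσ : 1 / 4 < σ) (hσ' : σ ≤ 1) :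
    ∃ Q : L2R, IsWeinsteinMinimizer σ Q ∧ (∀ᵐ x : ℝ, (Q x).im = 0) ∧
      IsGroundStateSolution σ Q := by
  have h0 : 0 ≤ σ := by linarith
  obtain ⟨g, hg, hpos, hle, hreal⟩ := exists_real_quartic_maximizer hσ hσ'
  set S := quartic σ g with hS
  -- The linear terms scale by `c` and the cubic term by `c³`, so `c² S = 1` removes the multiplier
  -- `S` from the Euler–Lagrange equation.
  set c : ℝ := (√S)⁻¹ with hc
  have hcpos : 0 < c := inv_pos.2 (Real.sqrt_pos.2 hpos)
  have hc2 : c ^ 2 * S = 1 := by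
    rw [hc, inv_pow, Real.sq_sqrt hpos.le, inv_mul_cancel₀ hpos.ne']
  have hg0 : g ≠ 0 := norm_pos_iff.1 (by rw [hg]; exact one_pos)
  have hc0 : (c : ℂ) ≠ 0 := by exact_mod_cast hcpos.ne'
  set q : L2R := (c : ℂ) • g with hq
  have hq0 : q ≠ 0 := smul_ne_zero hc0 hg0
  have hqS : quartic σ q = S * ‖q‖ ^ 4 := by
    rw [hq, quartic_smul, norm_smul, hg, mul_one, mul_comm]
  have hQx : ∀ᵐ x, besselOp σ q x = c * besselOp σ g x := by
    rw [hq, map_smul]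
    filter_upwards [Lp.coeFn_smul (c : ℂ) (besselOp σ g)] with x hx
    rw [hx, Pi.smul_apply, smul_eq_mul]
  have hmem := besselOp_mem_sobolevH h0 hσ' q
  refine ⟨besselOp σ q, ⟨hmem, besselOp_ne_zero hσ hσ' hq0, ?_⟩, ?_, hmem, ?_⟩
  · intro u hu hu0
    obtain ⟨h, rfl⟩ := exists_besselOp_eq h0 hu
    refine weinsteinW_besselOp_le_of_maximizer hσ hσ' hpos hle hq0 hqS ?_
    rintro rfl
    exact hu0 (map_zero _)
  · filter_upwards [hQx, hreal] with x h1 h2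
    rw [h1, Complex.im_ofReal_mul, h2, mul_zero]
  · intro v hv
    obtain ⟨h, rfl⟩ := exists_besselOp_eq h0 hv
    have hcube : ∫ x, besselOp σ q x ^ 3 * conj (besselOp σ h x)
        = (c : ℂ) ^ 3 * ((S : ℂ) * inner ℂ h g) := by
      rw [hS, quartic_maximizer_euler_lagrange hσ hσ' hg hle hreal h, ← integral_const_mul]
      refine integral_congr_ae ?_
      filter_upwards [hQx] with x hx
      rw [hx]
      ring
    have hc2' : (c : ℂ) ^ 2 * S = 1 := by exact_mod_cast hc2
    rw [inner_besselOp_add_kinetic, hcube, hq, inner_smul_right]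
    linear_combination (-(c : ℂ) * inner ℂ h g) * hc2'
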